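/- **Setting.** Let $S_1\colon H_1\to\mathcal G_1$ be a compact linear operator between real Hilbert spaces, and let $\lambda_1\ge\lambda_2\ge\dots\ge0$ be the eigenvalues of $S_1^\dagger S_1$, counted with multiplicity and extended by zeros if there are only finitely many positive ones. Assume $\lambda_2>0$. Let $(s_d)_{d\in\mathbb N}$ be any sequence of positive reals. For $d\in\mathbb N=\{1,2,\dots\}$ let $H_d$ and $\mathcal G_d$ be the $d$-fold Hilbert space tensor powers of $H_1$ and $\mathcal G_1$, let $\mathcal F_d$ be $H_d$ equipped with the inner product $\langle\cdot,\cdot\rangle_{\mathcal F_d}=s_d^{-1}\langle\cdot,\cdot\rangle_{H_d}$, and let $S_{d,s_d}=S_1\otimes\dots\otimes S_1\colon\mathcal F_d\to\mathcal G_d$. The sequence $S_{(s)}=(S_{d,s_d})_{d\in\mathbb N}$ is called a scaled tensor product problem. For $\varepsilon>0$ let $n(\varepsilon,d)$ be the least $n\in\mathbb N_0$ for which there is an algorithm $A(f)=\sum_{j=1}^n L_j(f)\,g_j$, with continuous linear functionals $L_j$ on $\mathcal F_d$ and $g_j\in\mathcal G_d$, whose worst case error $\sup_{\|f\|_{\mathcal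 F_d}\le1}\|S_{d,s_d}f-A(f)\|_{\mathcal G_d}$ is at most $\varepsilon$. Let $\varepsilon_d^{\mathrm{init}}$ be the initial error, i.e. the minimal worst case error of such algorithms with $n=0$. $S_{(s)}$ suffers from the *curse of dimensionality* if there are $\varepsilon,C,\gamma>0$ such that $n(\varepsilon,d)\ge C(1+\gamma)^d$ for infinitely many $d\in\mathbb N$. It is *weakly tractable* if $\ln n(\varepsilon_k,d_k)/(\varepsilon_k^{-1}+d_k)\to0$ for all sequences $(\varepsilon_k,d_k)\in(0,1]\times\mathbb N$ with $\varepsilon_k<\varepsilon_{d_k}^{\mathrm{init}}$ and $\varepsilon_k^{-1}+d_k\to\infty$. **Theorem.** We have $\varepsilon_d^{\mathrm{init}}=\sqrt{s_d\lambda_1^d}$ for all $d\in\mathbb N$, and the following holds. 1. Suppose that it is not the case that for every $\delta>0$ the bound $\ln\varepsilon_d^{\mathrm{init}}\le\delta d$ holds for all sufficiently large $d$; that is, $\limsup_{d\to\infty}\frac1d\ln\varepsilon_d^{\mathrm{init}}>0$, so that the initial error grows at least exponentially along some subsequence of dimensions. Then $S_{(s)}$ suffers from the curse of dimensionality. 2.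 Suppose that $\varepsilon_d^{\mathrm{init}}\in\Theta(d^\alpha)$ as $d\to\infty$, for some $\alpha\ge0$. - If $\lambda_1=\lambda_2$, then $S_{(s)}$ suffers from the curse of dimensionality. - If $\lambda_1>\lambda_2$, then $S_{(s)}$ is weakly tractable if and only if $\lambda_n\in o\big((\ln n)^{-2(1+\alpha)}\big)$ as $n\to\infty$. 3. Suppose that $\varepsilon_d^{\mathrm{init}}\to0$ as $d\to\infty$. Then $S_{(s)}$ does not suffer from the curse of dimensionality. Moreover, $S_{(s)}$ is weakly tractable if and only if - $\lambda_1=\lambda_2$, $\lambda_n\in o\big((\ln n)^{-2}\big)$ as $n\to\infty$, and $\varepsilon_d^{\mathrm{init}}\in o(1/d)$ as $d\to\infty$; or - $\lambda_1>\lambda_2$ and $\lambda_n\in o\big((\ln n)^{-2}\big)$ as $n\to\infty$. -/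

import Mathlib

open scoped TensorProduct InnerProductSpace
open Filter Topology Asymptotics

namespace IBC

/-! ### Hilbert tensor powers -/

section AlgebraicTensorPower

variable {H : Type*} [NormedAddCommGroup H] [InnerProductSpace ℝ H]
variable {G : Type*} [NormedAddCommGroup G] [InnerProductSpace ℝ G]

/-- The bilinear form on `H ⊗ ⋯ ⊗ H` (`d` factors) that is determined by
`⟨f₁ ⊗ ⋯ ⊗ f_d, g₁ ⊗ ⋯ ⊗ g_d⟩ = ∏ ⟨f_k, g_k⟩`. -/
noncomputable def tensorForm (H : Type*) [NormedAddCommGroup H] [InnerProductSpace ℝ H] (d : ℕ) :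
    (⨂[ℝ] _ : Fin d, H) →ₗ[ℝ] Module.Dual ℝ (⨂[ℝ] _ : Fin d, H) :=
  PiTensorProduct.dualDistrib ∘ₗ PiTensorProduct.map (fun _ => (innerₗ H : H →ₗ[ℝ] H →ₗ[ℝ] ℝ))

theorem tensorForm_tprod {d : ℕ} (f g : Fin d → H) :
    tensorForm H d (PiTensorProduct.tprod ℝ f) (PiTensorProduct.tprod ℝ g)
      = ∏ k, ⟪f k, g k⟫_ℝ := by
  simp [tensorForm]

theorem tensorForm_symm {d : ℕ} (x y : ⨂[ℝ] _ : Fin d, H) :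
    tensorForm H d x y = tensorForm H d y x := by
  induction x using PiTensorProduct.induction_on with
  | smul_tprod r f =>
    induction y using PiTensorProduct.induction_on with
    | smul_tprod r' g =>
      simp only [map_smul, LinearMap.smul_apply, tensorForm_tprod, smul_eq_mul]
      rw [Finset.prod_congr rfl fun k _ => real_inner_comm (g k) (f k)]
      ring
    | add a b ha hb => simp only [map_add, LinearMap.add_apply, ha, hb]
  | add a b ha hb => simp only [map_add, LinearMap.add_apply, ha, hb]

theorem exists_finiteDimensional_span {d : ℕ} (x : ⨂[ℝ] _ : Fin d, H) :
    ∃ V : Submodule ℝ H, FiniteDimensional ℝ V ∧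
      x ∈ Submodule.span ℝ (PiTensorProduct.tprod ℝ '' {f : Fin d → H | ∀ k, f k ∈ V}) := by
  induction x using PiTensorProduct.induction_on with
  | smul_tprod r f =>
    refine ⟨Submodule.span ℝ (Set.range f),
      FiniteDimensional.span_of_finite ℝ (Set.finite_range f), ?_⟩
    exact Submodule.smul_mem _ _ (Submodule.subset_span
      ⟨f, fun k => Submodule.subset_span ⟨k, rfl⟩, rfl⟩)
  | add a b ha hb =>
    obtain ⟨V, hV, ha⟩ := ha
    obtain ⟨W, hW, hb⟩ := hb
    refine ⟨V ⊔ W, inferInstance, Submodule.add_mem _ ?_ ?_⟩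
    · have hsub : {f : Fin d → H | ∀ k, f k ∈ V} ⊆ {f : Fin d → H | ∀ k, f k ∈ V ⊔ W} :=
        fun f hf k => (le_sup_left : V ≤ V ⊔ W) (hf k)
      exact Submodule.span_mono (Set.image_mono hsub) ha
    · have hsub : {f : Fin d → H | ∀ k, f k ∈ W} ⊆ {f : Fin d → H | ∀ k, f k ∈ V ⊔ W} :=
        fun f hf k => (le_sup_right : W ≤ V ⊔ W) (hf k)
      exact Submodule.span_mono (Set.image_mono hsub) hb

/-- Every algebraic tensor is a finite combination of simple tensors of orthonormal vectors, which
may be chosen such that a given operator maps them to orthogonal vectors. -/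
theorem exists_orthonormal_expansion [CompleteSpace G] {d : ℕ} (T : H →L[ℝ] G)
    (x : ⨂[ℝ] _ : Fin d, H) :
    ∃ (m : ℕ) (b : Fin m → H) (c : (Fin d → Fin m) → ℝ), Orthonormal ℝ b ∧
      (∀ i j, i ≠ j → ⟪T (b i), T (b j)⟫_ℝ = 0) ∧
      x = ∑ p, c p • PiTensorProduct.tprod ℝ (fun k => b (p k)) := by
  obtain ⟨V, hV, hx⟩ := exists_finiteDimensional_span x
  let TV : V →L[ℝ] G := T ∘L V.subtypeL
  let A : V →L[ℝ] V := (ContinuousLinearMap.adjoint TV) ∘L TV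
  have hA : (A : V →ₗ[ℝ] V).IsSymmetric := by
    intro v w
    simp [A, ContinuousLinearMap.adjoint_inner_left, ContinuousLinearMap.adjoint_inner_right]
  let e := hA.eigenvectorBasis rfl
  refine ⟨Module.finrank ℝ V, fun i => (e i : H), ?_⟩
  have hspan : x ∈ Submodule.span ℝ (Set.range fun p : Fin d → Fin (Module.finrank ℝ V) =>
      PiTensorProduct.tprod ℝ (fun k => (e (p k) : H))) := by
    refine Submodule.span_le.2 ?_ hx
    rintro _ ⟨f, hf, rfl⟩
    have hfk : f = fun k => ∑ i, ⟪e i, (⟨f k, hf k⟩ : V)⟫_ℝ • (e i : H) := by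
      funext k
      have := congrArg (Subtype.val) (e.sum_repr' (⟨f k, hf k⟩ : V))
      simpa using this.symm
    rw [hfk, MultilinearMap.map_sum]
    refine Submodule.sum_mem _ fun p _ => ?_
    rw [MultilinearMap.map_smul_univ]
    exact Submodule.smul_mem _ _ (Submodule.subset_span ⟨p, rfl⟩)
  obtain ⟨c, hc⟩ := (Submodule.mem_span_range_iff_exists_fun ℝ).1 hspan
  refine ⟨c, ?_, ?_, hc.symm⟩
  · exact e.orthonormal.comp_linearIsometry V.subtypeₗᵢ
  · intro i j hij
    have h1 : ⟪T (e i), T (e j)⟫_ℝ = ⟪A (e i), e j⟫_ℝ := by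
      simp [A, TV, ContinuousLinearMap.adjoint_inner_left]
    have h2 : A (e i) = (hA.eigenvalues rfl i) • e i := by
      exact hA.apply_eigenvectorBasis rfl i
    rw [h1, h2, inner_smul_left, e.orthonormal.2 hij, mul_zero]

theorem tensorForm_sum_tprod_self {d m : ℕ} (b : Fin m → H)
    (hb : ∀ i j, i ≠ j → ⟪b i, b j⟫_ℝ = 0) (c : (Fin d → Fin m) → ℝ) :
    tensorForm H d (∑ p, c p • PiTensorProduct.tprod ℝ (fun k => b (p k)))
      (∑ p, c p • PiTensorProduct.tprod ℝ (fun k => b (p k)))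
      = ∑ p, c p ^ 2 * ∏ k, ‖b (p k)‖ ^ 2 := by
  classical
  simp only [map_sum, map_smul, LinearMap.sum_apply, LinearMap.smul_apply, tensorForm_tprod,
    smul_eq_mul]
  refine Finset.sum_congr rfl fun p _ => ?_
  rw [Finset.sum_eq_single p]
  · simp only [real_inner_self_eq_norm_sq]
    ring
  · intro q _ hqp
    obtain ⟨k, hk⟩ : ∃ k, q k ≠ p k := by
      by_contra! h
      exact hqp (funext h)
    have : ∏ k, ⟪b (q k), b (p k)⟫_ℝ = 0 :=
      Finset.prod_eq_zero (Finset.mem_univ k) (hb _ _ hk)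
    simp [this]
  · simp

theorem tensorForm_nonneg_and_definite {d : ℕ} (x : ⨂[ℝ] _ : Fin d, H) :
    0 ≤ tensorForm H d x x ∧ (tensorForm H d x x = 0 → x = 0) := by
  obtain ⟨m, b, c, hb, -, rfl⟩ := exists_orthonormal_expansion (0 : H →L[ℝ] ℝ) x
  rw [tensorForm_sum_tprod_self b (fun i j hij => hb.2 hij)]
  simp only [hb.1, one_pow, Finset.prod_const_one, mul_one]
  refine ⟨Finset.sum_nonneg fun p _ => sq_nonneg _, fun h => ?_⟩
  refine Finset.sum_eq_zero fun p hp => ?_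
  have := (Finset.sum_eq_zero_iff_of_nonneg fun p _ => sq_nonneg (c p)).1 h p hp
  rw [pow_eq_zero_iff two_ne_zero] at this
  simp [this]

/-- The algebraic tensor power `H ⊗ ⋯ ⊗ H` with `d` factors. (A synonym, because the plain tensor
product already carries another norm in Mathlib.) -/
def AlgTensorPow (H : Type*) [NormedAddCommGroup H] [InnerProductSpace ℝ H] (d : ℕ) : Type _ :=
  ⨂[ℝ] _ : Fin d, H

noncomputable instance (d : ℕ) : AddCommGroup (AlgTensorPow H d) :=
  inferInstanceAs (AddCommGroup (⨂[ℝ] _ : Fin d, H))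

noncomputable instance (d : ℕ) : Module ℝ (AlgTensorPow H d) :=
  inferInstanceAs (Module ℝ (⨂[ℝ] _ : Fin d, H))

/-- The inner product with `⟨f₁ ⊗ ⋯ ⊗ f_d, g₁ ⊗ ⋯ ⊗ g_d⟩ = ∏ ⟨f_k, g_k⟩`. -/
@[reducible] noncomputable def algTensorPowCore (H : Type*) [NormedAddCommGroup H] [InnerProductSpace ℝ H]
    (d : ℕ) : InnerProductSpace.Core ℝ (AlgTensorPow H d) where
  inner x y := tensorForm H d x y
  conj_inner_symm x y := tensorForm_symm y x
  re_inner_nonneg x := (tensorForm_nonneg_and_definite x).1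
  add_left x y z := congrArg (fun L => L z) (map_add (tensorForm H d) x y)
  smul_left x y r := congrArg (fun L => L y) (map_smul (tensorForm H d) r x)
  definite x hx := (tensorForm_nonneg_and_definite x).2 hx

noncomputable instance (d : ℕ) : NormedAddCommGroup (AlgTensorPow H d) :=
  (algTensorPowCore H d).toNormedAddCommGroup

noncomputable instance (d : ℕ) : InnerProductSpace ℝ (AlgTensorPow H d) :=
  InnerProductSpace.ofCore (algTensorPowCore H d).toCore

theorem algTensorPow_norm_sq {d : ℕ} (x : AlgTensorPow H d) : ‖x‖ ^ 2 = tensorForm H d x x :=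
  (real_inner_self_eq_norm_sq x).symm

theorem norm_map_le [CompleteSpace G] {d : ℕ} (T : H →L[ℝ] G) (x : AlgTensorPow H d) :
    ‖(show AlgTensorPow G d from PiTensorProduct.map (fun _ => (T : H →ₗ[ℝ] G)) x)‖
      ≤ ‖T‖ ^ d * ‖x‖ := by
  refine abs_le_of_sq_le_sq' ?_ (by positivity) |>.2
  obtain ⟨m, b, c, hb, hTb, hx⟩ := exists_orthonormal_expansion T x
  have hTx : PiTensorProduct.map (fun _ : Fin d => (T : H →ₗ[ℝ] G)) x
      = ∑ p, c p • PiTensorProduct.tprod ℝ (fun k => T (b (p k))) := by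
    rw [hx]
    simp only [map_sum, map_smul, PiTensorProduct.map_tprod, ContinuousLinearMap.coe_coe]
  rw [mul_pow, algTensorPow_norm_sq, algTensorPow_norm_sq, hTx,
    tensorForm_sum_tprod_self (fun i => T (b i)) hTb c, hx,
    tensorForm_sum_tprod_self b (fun i j hij => hb.2 hij)]
  rw [Finset.mul_sum]
  refine Finset.sum_le_sum fun p _ => ?_
  have hk : ∏ k, ‖T (b (p k))‖ ^ 2 ≤ ∏ _k : Fin d, ‖T‖ ^ 2 := by
    refine Finset.prod_le_prod (fun k _ => by positivity) fun k _ => ?_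
    have := T.le_opNorm (b (p k))
    rw [hb.1, mul_one] at this
    gcongr
  simp only [hb.1, one_pow, Finset.prod_const_one, mul_one]
  rw [Finset.prod_const, Finset.card_univ, Fintype.card_fin] at hk
  calc c p ^ 2 * ∏ k, ‖T (b (p k))‖ ^ 2 ≤ c p ^ 2 * (‖T‖ ^ 2) ^ d := by gcongr
    _ = (‖T‖ ^ d) ^ 2 * c p ^ 2 := by ring

/-- The `d`-fold tensor power `T ⊗ ⋯ ⊗ T` on the algebraic tensor power. -/
noncomputable def algTensorPowMap [CompleteSpace G] (T : H →L[ℝ] G) (d : ℕ) :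
    AlgTensorPow H d →L[ℝ] AlgTensorPow G d :=
  LinearMap.mkContinuous
    (show AlgTensorPow H d →ₗ[ℝ] AlgTensorPow G d from
      PiTensorProduct.map (fun _ => (T : H →ₗ[ℝ] G)))
    (‖T‖ ^ d) (norm_map_le T)

end AlgebraicTensorPower

/-- The Hilbert space tensor power `H_d = H ⊗ ⋯ ⊗ H` with `d` factors: the completion of the
algebraic tensor power with respect to its inner product. -/
abbrev HilbertTensorPow (H : Type*) [NormedAddCommGroup H] [InnerProductSpace ℝ H] (d : ℕ) :
    Type _ :=
  UniformSpace.Completion (AlgTensorPow H d)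

/-- The tensor power operator `S_d = S ⊗ ⋯ ⊗ S : H_d → G_d`, the continuous extension of
`f₁ ⊗ ⋯ ⊗ f_d ↦ S f₁ ⊗ ⋯ ⊗ S f_d`. -/
noncomputable def tensorPowMap {H G : Type*} [NormedAddCommGroup H] [InnerProductSpace ℝ H]
    [NormedAddCommGroup G] [InnerProductSpace ℝ G] [CompleteSpace G] (S : H →L[ℝ] G) (d : ℕ) :
    HilbertTensorPow H d →L[ℝ] HilbertTensorPow G d :=
  (algTensorPowMap S d).completion

/-! ### Scaled norms -/

section Scaled

variable {E : Type*} [NormedAddCommGroup E] [InnerProductSpace ℝ E]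

/-- The space `E` equipped with the inner product `⟨x, y⟩ = c⁻¹ ⟨x, y⟩_E`, where `c > 0`. -/
def ScaledSpace (_c : {x : ℝ // 0 < x}) (E : Type*) [NormedAddCommGroup E]
    [InnerProductSpace ℝ E] : Type _ := E

instance (c : {x : ℝ // 0 < x}) : AddCommGroup (ScaledSpace c E) :=
  inferInstanceAs (AddCommGroup E)

instance (c : {x : ℝ // 0 < x}) : Module ℝ (ScaledSpace c E) :=
  inferInstanceAs (Module ℝ E)

/-- The identity map from the scaled space to the original space. -/
def ScaledSpace.toBase (c : {x : ℝ // 0 < x}) (E : Type*) [NormedAddCommGroup E]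
    [InnerProductSpace ℝ E] : ScaledSpace c E →ₗ[ℝ] E :=
  (LinearMap.id : E →ₗ[ℝ] E)

/-- The inner product `⟨x, y⟩ = c⁻¹ ⟨x, y⟩_E`. -/
@[reducible] noncomputable def scaledCore (c : {x : ℝ // 0 < x}) (E : Type*)
    [NormedAddCommGroup E] [InnerProductSpace ℝ E] :
    InnerProductSpace.Core ℝ (ScaledSpace c E) where
  inner x y := (c : ℝ)⁻¹ * inner ℝ (ScaledSpace.toBase c E x) (ScaledSpace.toBase c E y)
  conj_inner_symm x y := congrArg (fun t : ℝ => (c : ℝ)⁻¹ * t)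
    (real_inner_comm (ScaledSpace.toBase c E x) (ScaledSpace.toBase c E y))
  re_inner_nonneg x := mul_nonneg (inv_nonneg.2 c.2.le) real_inner_self_nonneg
  add_left x y z := by rw [map_add, inner_add_left, mul_add]
  smul_left x y r := by
    rw [map_smul, real_inner_smul_left, mul_left_comm]
    rfl
  definite x hx := (inner_self_eq_zero (𝕜 := ℝ) (x := ScaledSpace.toBase c E x)).1
    ((mul_eq_zero.1 hx).resolve_left (inv_ne_zero c.2.ne'))

noncomputable instance (c : {x : ℝ // 0 < x}) : NormedAddCommGroup (ScaledSpace c E) :=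
  (scaledCore c E).toNormedAddCommGroup

noncomputable instance (c : {x : ℝ // 0 < x}) : InnerProductSpace ℝ (ScaledSpace c E) :=
  InnerProductSpace.ofCore (scaledCore c E).toCore

theorem scaledSpace_norm_sq (c : {x : ℝ // 0 < x}) (x : ScaledSpace c E) :
    ‖x‖ ^ 2 = (c : ℝ)⁻¹ * ‖ScaledSpace.toBase c E x‖ ^ 2 := by
  rw [← real_inner_self_eq_norm_sq x, ← real_inner_self_eq_norm_sq (ScaledSpace.toBase c E x)]
  rfl

theorem norm_toBase_le (c : {x : ℝ // 0 < x}) (x : ScaledSpace c E) :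
    ‖ScaledSpace.toBase c E x‖ ≤ √(c : ℝ) * ‖x‖ := by
  refine abs_le_of_sq_le_sq' ?_ (by positivity) |>.2
  rw [mul_pow, Real.sq_sqrt c.2.le, scaledSpace_norm_sq, mul_inv_cancel_left₀ c.2.ne']

/-- The operator `T`, regarded as an operator on the scaled space. -/
noncomputable def scaledOp {G : Type*} [NormedAddCommGroup G] [InnerProductSpace ℝ G]
    (c : {x : ℝ // 0 < x}) (T : E →L[ℝ] G) : ScaledSpace c E →L[ℝ] G :=
  LinearMap.mkContinuous ((T : E →ₗ[ℝ] G) ∘ₗ ScaledSpace.toBase c E) (‖T‖ * √(c : ℝ))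
    fun x => (T.le_opNorm (ScaledSpace.toBase c E x)).trans <| by
      rw [mul_assoc]
      exact mul_le_mul_of_nonneg_left (norm_toBase_le c x) (norm_nonneg T)

end Scaled

/-- The scaled tensor product problem `S_{(s)} = (S_{d,s_d} : F_d → G_d)_d`: here
`S_{d,s_d} = S ⊗ ⋯ ⊗ S` (`d` factors), and `F_d` is the tensor power `H_d` with the inner product
`⟨·,·⟩ / s_d`. -/
noncomputable def scaledTensorProblem {H G : Type*} [NormedAddCommGroup H]
    [InnerProductSpace ℝ H] [NormedAddCommGroup G] [InnerProductSpace ℝ G] [CompleteSpace G]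
    (S : H →L[ℝ] G) (s : ℕ → {x : ℝ // 0 < x}) (d : ℕ) :
    ScaledSpace (s d) (HilbertTensorPow H d) →L[ℝ] HilbertTensorPow G d :=
  scaledOp (s d) (tensorPowMap S d)

/-! ### Squared singular values -/

/-- The `n`-th largest (`n = 1, 2, …`) positive eigenvalue of `W`, counted with multiplicity:
the largest `μ > 0` such that the eigenspaces for the eigenvalues `≥ μ` together have dimension at
least `n`. It is `0` if there are fewer than `n` positive eigenvalues, since `sSup ∅ = 0`. -/
noncomputable def nthEigenvalue {E : Type*} [NormedAddCommGroup E] [InnerProductSpace ℝ E]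
    (W : E →L[ℝ] E) (n : ℕ) : ℝ :=
  sSup {μ : ℝ | 0 < μ ∧ (n : Cardinal) ≤
    Module.rank ℝ ↥(⨆ ν ∈ Set.Ici μ, Module.End.eigenspace (W : E →ₗ[ℝ] E) ν)}

/-- The squared singular values `λ₁ ≥ λ₂ ≥ ⋯ ≥ 0` of `S`: the eigenvalues of `W = S† S`, counted
with multiplicity and extended by zeros. -/
noncomputable def sqSingularValue {H G : Type*} [NormedAddCommGroup H] [InnerProductSpace ℝ H]
    [CompleteSpace H] [NormedAddCommGroup G] [InnerProductSpace ℝ G] [CompleteSpace G]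
    (S : H →L[ℝ] G) (n : ℕ) : ℝ :=
  nthEigenvalue (ContinuousLinearMap.adjoint S ∘L S) n

/-! ### Worst case errors and information complexity -/

section Complexity

variable {F G : Type*} [NormedAddCommGroup F] [NormedSpace ℝ F]
  [NormedAddCommGroup G] [NormedSpace ℝ G]

/-- Linear non-adaptive algorithms `A f = ∑_{j ≤ n} L_j(f) g_j` that use `n` continuous linear
functionals `L_j` as information on `f`. -/
def IsLinearAlgorithm (n : ℕ) (A : F → G) : Prop :=
  ∃ (L : Fin n → (F →L[ℝ] ℝ)) (g : Fin n → G), ∀ f, A f = ∑ j, L j f • g j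

/-- The worst case error of `A` on the unit ball of the source space. -/
noncomputable def worstCaseError (S : F →L[ℝ] G) (A : F → G) : ENNReal :=
  ⨆ f ∈ Metric.closedBall (0 : F) 1, ‖S f - A f‖ₑ

/-- The `n`-th minimal worst case error. -/
noncomputable def minimalError (S : F →L[ℝ] G) (n : ℕ) : ENNReal :=
  ⨅ (A : F → G) (_ : IsLinearAlgorithm n A), worstCaseError S A

/-- The initial error: the `0`-th minimal worst case error. -/
noncomputable def initialError (S : F →L[ℝ] G) : ℝ :=
  (minimalError S 0).toReal

/-- The information complexity for the absolute error criterion: the least number `n` of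
information operations such that some algorithm has worst case error at most `ε`. (For a compact
operator between Hilbert spaces and `ε > 0` such an `n` exists.) -/
noncomputable def infoComplexity (S : F →L[ℝ] G) (ε : ℝ) : ℕ :=
  sInf {n : ℕ | ∃ A : F → G, IsLinearAlgorithm n A ∧ worstCaseError S A ≤ ENNReal.ofReal ε}

end Complexity

/-! ### Tractability of sequences of problems -/

section Tractability

variable {F G : ℕ → Type*} [∀ d, NormedAddCommGroup (F d)] [∀ d, NormedSpace ℝ (F d)]
  [∀ d, NormedAddCommGroup (G d)] [∀ d, NormedSpace ℝ (G d)]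

/-- The curse of dimensionality: for some `ε > 0` there are `C, γ > 0` with
`n(ε, d) ≥ C (1 + γ)^d` for infinitely many `d`. -/
def CurseOfDimensionality (P : ∀ d, F d →L[ℝ] G d) : Prop :=
  ∃ ε : ℝ, 0 < ε ∧ ∃ C : ℝ, 0 < C ∧ ∃ γ : ℝ, 0 < γ ∧
    ∃ᶠ d : ℕ in atTop, C * (1 + γ) ^ d ≤ (infoComplexity (P d) ε : ℝ)

/-- Weak tractability: `ln n(ε, d) / (ε⁻¹ + d) → 0` as `ε⁻¹ + d → ∞`, along all sequences of pairs
`(ε, d)` with `ε ∈ (0, 1]`, `d ≥ 1` and `ε` smaller than the initial error in dimension `d`. -/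
def WeaklyTractable (P : ∀ d, F d →L[ℝ] G d) : Prop :=
  ∀ (ε : ℕ → ℝ) (d : ℕ → ℕ),
    (∀ k, 0 < ε k ∧ ε k ≤ 1 ∧ 1 ≤ d k ∧ ε k < initialError (P (d k))) →
    Tendsto (fun k => (ε k)⁻¹ + (d k : ℝ)) atTop atTop →
    Tendsto (fun k => Real.log (infoComplexity (P (d k)) (ε k)) / ((ε k)⁻¹ + (d k : ℝ)))
      atTop (𝓝 0)

end Tractability

end IBC

/-! The whole problem reduces to counting. A compact `S` has orthonormal singular vectors `v₀, v₁,
…` with squared singular values `ν₀ ≥ ν₁ ≥ … → 0`. The tensors `v_{p₁} ⊗ ⋯ ⊗ v_{p_d}` are then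
singular vectors of the tensor power with squared singular values `∏ ν (p k)`, and scaling the norm
multiplies these by `s d`. Truncating the singular expansion is optimal, so the complexity is
exactly the number of `p` with `∏ ν (p k) > ε² / s_d` (`infoComplexity_scaledTensorProblem`). The
initial error is the largest singular value. Dividing by it gives a spectrum `μ n = ν n / ν 0` with
`μ 0 = 1` and the threshold `(ε / init)²`; `HasTensorSpectrum` records this, and the spaces play no
further role.

Two lower bounds for the count suffice. Indices with entries in `{0, 1}`, nonzero only on `k` fixed
coordinates, give `2 ^ k` (`two_pow_le_ncard`); this yields every curse statement and the condition
`o(1/d)`. Varying a single coordinate gives `m + 1` (`succ_le_ncard`); this yields the necessary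
decay of the spectrum, on choosing `ε` and `d` of balanced size.

The upper bound is `ncard_largeIndices_le`: a large product has at most `m` entries `≥ r`, at most
one entry `≥ A` and none `≥ B`, so there are at most `r ^ d (dA) ^ m (dB)` of them. With `Y = ε⁻¹ +
d` and the assumed decay, `m` is of order `log Y`, `log A` of order `√Y`, and `log B` is at most a
small multiple of `Y` up to a constant. What remains is `d log r`: it vanishes if `μ 1 < 1`, since
`r = 1` is allowed, and it is negligible if the initial error is `o(1/d)`, since then `ε < init`
forces `d = o(ε⁻¹)`. -/

namespace IBC

/-! ### Singular value decomposition of a compact operator by successive deflation. -/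

section SingularValues

variable {H : Type*} [NormedAddCommGroup H] [InnerProductSpace ℝ H]
variable {G : Type*} [NormedAddCommGroup G] [InnerProductSpace ℝ G]

/-- Expanding the square shows that near-maximizers of `‖T x‖` on the unit ball are approximate
eigenvectors of `T† T` for `‖T‖ ^ 2`. -/
theorem norm_sq_adjoint_sub_le [CompleteSpace H] [CompleteSpace G] (T : H →L[ℝ] G) {x : H}
    (hx : ‖x‖ ≤ 1) :
    ‖ContinuousLinearMap.adjoint T (T x) - ‖T‖ ^ 2 • x‖ ^ 2
      ≤ 2 * ‖T‖ ^ 2 * (‖T‖ ^ 2 - ‖T x‖ ^ 2) := by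
  rw [norm_sub_sq_real, inner_smul_right, ContinuousLinearMap.adjoint_inner_left,
    real_inner_self_eq_norm_sq, norm_smul, Real.norm_of_nonneg (by positivity)]
  have h1 : ‖ContinuousLinearMap.adjoint T (T x)‖ ≤ ‖T‖ * ‖T x‖ := by
    simpa using (ContinuousLinearMap.adjoint T).le_opNorm (T x)
  have h2 : ‖T x‖ ≤ ‖T‖ := by
    simpa using (T.le_opNorm x).trans (mul_le_mul_of_nonneg_left hx (norm_nonneg T))
  have h3 : ‖ContinuousLinearMap.adjoint T (T x)‖ ≤ ‖T‖ ^ 2 := by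
    rw [sq]
    exact h1.trans (mul_le_mul_of_nonneg_left h2 (norm_nonneg T))
  have h4 : ‖ContinuousLinearMap.adjoint T (T x)‖ ^ 2 ≤ (‖T‖ ^ 2) ^ 2 := by gcongr
  have h5 : (‖T‖ ^ 2 * ‖x‖) ^ 2 ≤ (‖T‖ ^ 2 * 1) ^ 2 := by gcongr
  nlinarith

/-- A nonzero compact operator attains its norm at a singular vector. -/
theorem exists_norm_attaining_vector [CompleteSpace H] [CompleteSpace G] {T : H →L[ℝ] G}
    (hT : IsCompactOperator T) (hT0 : T ≠ 0) :
    ∃ x : H, ‖x‖ = 1 ∧ ∀ z, ⟪T x, T z⟫_ℝ = ‖T‖ ^ 2 * ⟪x, z⟫_ℝ := by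
  have hpos : 0 < ‖T‖ := norm_pos_iff.2 hT0
  have hex : ∀ k : ℕ, ∃ x : H, ‖x‖ < 1 ∧ ‖T‖ - 1 / ((k : ℝ) + 1) < ‖T x‖ := fun k =>
    T.exists_lt_apply_of_lt_opNorm (sub_lt_self _ (by positivity))
  choose u hu1 hu2 using hex
  have huT : ∀ k, ‖T (u k)‖ ≤ ‖T‖ := fun k => by
    simpa using (T.le_opNorm (u k)).trans (mul_le_mul_of_nonneg_left (hu1 k).le (norm_nonneg T))
  have hlim : Tendsto (fun k => ‖T (u k)‖) atTop (𝓝 ‖T‖) := by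
    refine tendsto_of_tendsto_of_tendsto_of_le_of_le (g := fun k : ℕ => ‖T‖ - 1 / ((k : ℝ) + 1))
      ?_ tendsto_const_nhds (fun k => (hu2 k).le) huT
    simpa using tendsto_const_nhds.sub (tendsto_one_div_add_atTop_nhds_zero_nat (𝕜 := ℝ))
  obtain ⟨y, -, φ, hφ, hy⟩ := (hT.isCompact_closure_image_ball (𝕜₁ := ℝ) 1).tendsto_subseq
    (x := fun k => T (u k))
    (fun k => subset_closure ⟨u k, by simpa using hu1 k, rfl⟩)
  have hdiff : Tendsto (fun k => ContinuousLinearMap.adjoint T (T (u k)) - ‖T‖ ^ 2 • u k) atTop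
      (𝓝 0) := by
    rw [tendsto_zero_iff_norm_tendsto_zero]
    have hb : Tendsto (fun k => √(2 * ‖T‖ ^ 2 * (‖T‖ ^ 2 - ‖T (u k)‖ ^ 2))) atTop (𝓝 0) := by
      have h := (((hlim.pow 2).const_sub (‖T‖ ^ 2)).const_mul (2 * ‖T‖ ^ 2)).sqrt
      simpa using h
    refine squeeze_zero (fun _ => norm_nonneg _) (fun k => ?_) hb
    exact Real.le_sqrt_of_sq_le (norm_sq_adjoint_sub_le T (hu1 k).le)
  -- Both `T† T u_k` (by compactness, along `φ`) and `T† T u_k - ‖T‖² u_k` converge, so the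
  -- maximizing sequence itself converges in norm.
  have hconv : Tendsto (fun k => u (φ k)) atTop
      (𝓝 ((‖T‖ ^ 2)⁻¹ • ContinuousLinearMap.adjoint T y)) := by
    have h1 := ((ContinuousLinearMap.adjoint T).continuous.tendsto y).comp hy
    have h2 := (h1.sub (hdiff.comp hφ.tendsto_atTop)).const_smul (‖T‖ ^ 2)⁻¹
    rw [sub_zero] at h2
    refine h2.congr fun k => ?_
    simp [smul_smul, hpos.ne']
  set x := (‖T‖ ^ 2)⁻¹ • ContinuousLinearMap.adjoint T y with hx
  have hTx : ‖T x‖ = ‖T‖ :=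
    tendsto_nhds_unique ((((T.continuous.tendsto x).comp hconv)).norm)
      (hlim.comp hφ.tendsto_atTop)
  have hx1 : ‖x‖ ≤ 1 := le_of_tendsto' hconv.norm fun k => (hu1 _).le
  have hx1' : ‖x‖ = 1 := by
    refine le_antisymm hx1 ?_
    have := T.le_opNorm x
    rw [hTx] at this
    exact le_of_mul_le_mul_left (by simpa using this) hpos
  refine ⟨x, hx1', fun z => ?_⟩
  have h0 := norm_sq_adjoint_sub_le T hx1
  rw [hTx, sub_self, mul_zero] at h0
  have h1 : ContinuousLinearMap.adjoint T (T x) = ‖T‖ ^ 2 • x := by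
    rw [← sub_eq_zero, ← norm_eq_zero]
    exact pow_eq_zero_iff two_ne_zero |>.1 (le_antisymm h0 (sq_nonneg _))
  rw [← ContinuousLinearMap.adjoint_inner_left, h1, inner_smul_left]
  simp

open Classical in
/-- A unit vector at which `T` attains its norm and which is a singular vector; `0` if there is
none or if `T = 0`. -/
noncomputable def topVector (T : H →L[ℝ] G) : H :=
  if h : T ≠ 0 ∧ ∃ x : H, ‖x‖ = 1 ∧ ∀ z, ⟪T x, T z⟫_ℝ = ‖T‖ ^ 2 * ⟪x, z⟫_ℝ then h.2.choose else 0

theorem inner_topVector (T : H →L[ℝ] G) (z : H) :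
    ⟪T (topVector T), T z⟫_ℝ = ‖T‖ ^ 2 * ⟪topVector T, z⟫_ℝ := by
  unfold topVector
  split_ifs with h
  · exact h.2.choose_spec.2 z
  · simp

theorem topVector_eq_zero {T : H →L[ℝ] G} (hT : T = 0) : topVector T = 0 := by
  simp [topVector, hT]

theorem norm_topVector [CompleteSpace H] [CompleteSpace G] {T : H →L[ℝ] G}
    (hT : IsCompactOperator T) (hT0 : T ≠ 0) : ‖topVector T‖ = 1 := by
  have h : T ≠ 0 ∧ ∃ x : H, ‖x‖ = 1 ∧ ∀ z, ⟪T x, T z⟫_ℝ = ‖T‖ ^ 2 * ⟪x, z⟫_ℝ :=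
    ⟨hT0, exists_norm_attaining_vector hT hT0⟩
  rw [topVector, dif_pos h]
  exact h.2.choose_spec.1

/-- The operator `S` with its first `n` singular directions removed. -/
noncomputable def deflation (S : H →L[ℝ] G) : ℕ → (H →L[ℝ] G)
  | 0 => S
  | n + 1 => deflation S n ∘L (ContinuousLinearMap.id ℝ H -
      (innerSL ℝ (topVector (deflation S n))).smulRight (topVector (deflation S n)))

/-- The `n`-th singular vector of `S`, for `n = 0, 1, …`. -/
noncomputable def singularVector (S : H →L[ℝ] G) (n : ℕ) : H := topVector (deflation S n)

/-- The `n`-th squared singular value of `S`, for `n = 0, 1, …`. -/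
noncomputable def singularSq (S : H →L[ℝ] G) (n : ℕ) : ℝ := ‖deflation S n‖ ^ 2

theorem singularSq_nonneg (S : H →L[ℝ] G) (n : ℕ) : 0 ≤ singularSq S n := sq_nonneg _

theorem singularSq_zero (S : H →L[ℝ] G) : singularSq S 0 = ‖S‖ ^ 2 := rfl

theorem deflation_succ_apply (S : H →L[ℝ] G) (n : ℕ) (z : H) :
    deflation S (n + 1) z = deflation S n z -
      ⟪singularVector S n, z⟫_ℝ • deflation S n (singularVector S n) := by
  simp [deflation, singularVector]

theorem inner_deflation_singularVector (S : H →L[ℝ] G) (n : ℕ) (z : H) :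
    ⟪deflation S n (singularVector S n), deflation S n z⟫_ℝ
      = singularSq S n * ⟪singularVector S n, z⟫_ℝ :=
  inner_topVector _ z

theorem isCompactOperator_deflation {S : H →L[ℝ] G} (hS : IsCompactOperator S) (n : ℕ) :
    IsCompactOperator (deflation S n) := by
  induction n with
  | zero => exact hS
  | succ n ih => exact ih.comp_clm _

theorem singularVector_eq_zero {S : H →L[ℝ] G} {n : ℕ} (h : singularSq S n = 0) :
    singularVector S n = 0 :=
  topVector_eq_zero (norm_eq_zero.1 (pow_eq_zero_iff two_ne_zero |>.1 h))

theorem deflation_apply_of_orthogonal {S : H →L[ℝ] G} {n : ℕ} {z : H}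
    (hz : ∀ i < n, ⟪singularVector S i, z⟫_ℝ = 0) : deflation S n z = S z := by
  induction n with
  | zero => rfl
  | succ n ih =>
    rw [deflation_succ_apply, hz n (Nat.lt_succ_self n), zero_smul, sub_zero]
    exact ih fun i hi => hz i (hi.trans (Nat.lt_succ_self n))

/-- One half of the min-max principle: on the orthogonal complement of the first `n` singular
vectors, `S` agrees with its deflation. -/
theorem norm_apply_sq_le_of_orthogonal {S : H →L[ℝ] G} {n : ℕ} {z : H}
    (hz : ∀ i < n, ⟪singularVector S i, z⟫_ℝ = 0) : ‖S z‖ ^ 2 ≤ singularSq S n * ‖z‖ ^ 2 := by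
  rw [← deflation_apply_of_orthogonal hz, singularSq, ← mul_pow]
  gcongr
  exact (deflation S n).le_opNorm z

variable [CompleteSpace H] [CompleteSpace G] {S : H →L[ℝ] G}

theorem norm_singularVector (hS : IsCompactOperator S) {n : ℕ} (h : singularSq S n ≠ 0) :
    ‖singularVector S n‖ = 1 :=
  norm_topVector (isCompactOperator_deflation hS n) fun h0 => h (by simp [singularSq, h0])

/-- A singular vector is a unit vector or, for singular value `0`, the default `0`; this identity
covers both and spares later case distinctions. -/
theorem singularSq_mul_norm_sq (hS : IsCompactOperator S) (n : ℕ) :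
    singularSq S n * ‖singularVector S n‖ ^ 2 = singularSq S n := by
  by_cases h : singularSq S n = 0
  · simp [h]
  · simp [norm_singularVector hS h]

/-- On the level of `S† S`, one deflation step subtracts the rank-one form of the current singular
vector. Monotonicity, orthogonality and the eigenvector equation all follow from this. -/
theorem inner_deflation_succ (hS : IsCompactOperator S) (n : ℕ) (x z : H) :
    ⟪deflation S (n + 1) x, deflation S (n + 1) z⟫_ℝ = ⟪deflation S n x, deflation S n z⟫_ℝ
      - singularSq S n * (⟪singularVector S n, x⟫_ℝ * ⟪singularVector S n, z⟫_ℝ) := by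
  have h := singularSq_mul_norm_sq hS n
  rw [deflation_succ_apply, deflation_succ_apply, inner_sub_left, inner_sub_right, inner_sub_right,
    real_inner_smul_left, real_inner_smul_left, real_inner_smul_right, real_inner_smul_right,
    inner_deflation_singularVector, inner_deflation_singularVector,
    real_inner_comm (deflation S n (singularVector S n)) (deflation S n x),
    inner_deflation_singularVector, real_inner_self_eq_norm_sq, h]
  ring

theorem singularSq_antitone (hS : IsCompactOperator S) : Antitone (singularSq S) := by
  refine antitone_nat_of_succ_le fun n => ?_
  unfold singularSq
  gcongr
  refine ContinuousLinearMap.opNorm_le_bound _ (norm_nonneg _) fun x => ?_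
  refine le_trans ?_ ((deflation S n).le_opNorm x)
  refine abs_le_of_sq_le_sq' ?_ (norm_nonneg _) |>.2
  rw [← real_inner_self_eq_norm_sq, ← real_inner_self_eq_norm_sq, inner_deflation_succ hS]
  have := mul_nonneg (singularSq_nonneg S n) (mul_self_nonneg ⟪singularVector S n, x⟫_ℝ)
  linarith

theorem deflation_singularVector (hS : IsCompactOperator S) {i n : ℕ} (h : i < n) :
    deflation S n (singularVector S i) = 0 := by
  induction n with
  | zero => omega
  | succ n ih =>
    rcases (Nat.lt_succ_iff_lt_or_eq.1 h) with h | rfl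
    · rw [deflation_succ_apply, ih h, zero_sub, neg_eq_zero]
      have h1 := inner_deflation_singularVector S n (singularVector S i)
      rw [ih h, inner_zero_right] at h1
      rcases mul_eq_zero.1 h1.symm with h2 | h2
      · simp [singularVector_eq_zero h2]
      · simp [h2]
    · rw [← norm_eq_zero, ← sq_eq_zero_iff, ← real_inner_self_eq_norm_sq, inner_deflation_succ hS,
        inner_deflation_singularVector, real_inner_self_eq_norm_sq]
      have h := singularSq_mul_norm_sq hS i
      linear_combination -‖singularVector S i‖ ^ 2 * h

theorem inner_singularVector_of_lt (hS : IsCompactOperator S) {i n : ℕ} (h : i < n) :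
    ⟪singularVector S n, singularVector S i⟫_ℝ = 0 := by
  have h1 := inner_deflation_singularVector S n (singularVector S i)
  rw [deflation_singularVector hS h, inner_zero_right] at h1
  rcases mul_eq_zero.1 h1.symm with h2 | h2
  · simp [singularVector_eq_zero h2]
  · exact h2

theorem inner_singularVector (hS : IsCompactOperator S) {i n : ℕ} (h : i ≠ n) :
    ⟪singularVector S n, singularVector S i⟫_ℝ = 0 := by
  rcases lt_or_gt_of_ne h with h | h
  · exact inner_singularVector_of_lt hS h
  · rw [real_inner_comm]
    exact inner_singularVector_of_lt hS h

/-- The rank-one forms subtracted before step `n` vanish on the `n`-th singular vector by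
orthogonality, so its singular relation for the deflation is one for `S`. -/
theorem inner_apply_singularVector (hS : IsCompactOperator S) (n : ℕ) (z : H) :
    ⟪S (singularVector S n), S z⟫_ℝ = singularSq S n * ⟪singularVector S n, z⟫_ℝ := by
  rw [← inner_deflation_singularVector]
  have h : ∀ m ≤ n, ⟪deflation S m (singularVector S n), deflation S m z⟫_ℝ
      = ⟪S (singularVector S n), S z⟫_ℝ := by
    intro m
    induction m with
    | zero => intro _; rfl
    | succ m ih =>
      intro hm
      rw [inner_deflation_succ hS, inner_singularVector hS (by omega), ih (by omega)]
      ring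
  exact (h n le_rfl).symm

theorem norm_apply_singularVector_sq (hS : IsCompactOperator S) (n : ℕ) :
    ‖S (singularVector S n)‖ ^ 2 = singularSq S n := by
  rw [← real_inner_self_eq_norm_sq, inner_apply_singularVector hS, real_inner_self_eq_norm_sq,
    singularSq_mul_norm_sq hS]

/-- If all values were at least `c > 0`, the images of the singular vectors would be orthogonal with
pairwise squared distance at least `2c`, contradicting compactness. -/
theorem tendsto_singularSq (hS : IsCompactOperator S) : Tendsto (singularSq S) atTop (𝓝 0) := by
  by_contra hcon
  obtain ⟨c, hc, hcn⟩ : ∃ c : ℝ, 0 < c ∧ ∀ n, c ≤ singularSq S n := by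
    by_contra! h
    refine hcon (tendsto_order.2 ⟨fun a ha => Eventually.of_forall fun n =>
      ha.trans_le (singularSq_nonneg S n), fun a ha => ?_⟩)
    obtain ⟨n, hn⟩ := h a ha
    filter_upwards [eventually_ge_atTop n] with m hm
    exact (singularSq_antitone hS hm).trans_lt hn
  obtain ⟨y, -, φ, hφ, hy⟩ := (hS.isCompact_closure_image_closedBall (𝕜₁ := ℝ) 1).tendsto_subseq
    (x := fun k => S (singularVector S k))
    (fun k => subset_closure ⟨singularVector S k, by
      simp [norm_singularVector hS (hc.trans_le (hcn k)).ne'], rfl⟩)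
  obtain ⟨N, hN⟩ := Metric.cauchySeq_iff'.1 hy.cauchySeq (√c) (Real.sqrt_pos.2 hc)
  have h1 := hN (N + 1) (Nat.le_succ N)
  rw [dist_eq_norm, Real.lt_sqrt (norm_nonneg _)] at h1
  have hne : φ N ≠ φ (N + 1) := (hφ (Nat.lt_succ_self N)).ne
  simp only [Function.comp] at h1
  rw [norm_sub_sq_real, inner_apply_singularVector hS, inner_singularVector hS hne,
    norm_apply_singularVector_sq hS, norm_apply_singularVector_sq hS] at h1
  have := hcn (φ N)
  have := hcn (φ (N + 1))
  linarith

end SingularValues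

/-! ### Identification of the deflation values with the eigenvalues of `S† S`. -/

theorem exists_ne_zero_orthogonal {H : Type*} [NormedAddCommGroup H]
    [InnerProductSpace ℝ H] {V : Submodule ℝ H} {n : ℕ}
    (hV : ((n + 1 : ℕ) : Cardinal) ≤ Module.rank ℝ V) (e : ℕ → H) :
    ∃ x ∈ V, x ≠ 0 ∧ ∀ i < n, ⟪e i, x⟫_ℝ = 0 := by
  obtain ⟨f, hf⟩ := Module.le_rank_iff_exists_linearMap.1 hV
  let φ : (Fin (n + 1) → ℝ) →ₗ[ℝ] (Fin n → ℝ) :=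
    LinearMap.pi fun i => (innerₗ H (e i)) ∘ₗ V.subtype ∘ₗ f
  obtain ⟨c, hc, hc0⟩ := Submodule.exists_mem_ne_zero_of_ne_bot
    (φ.ker_ne_bot_of_finrank_lt (by simp))
  refine ⟨f c, (f c).2, fun h => hc0 (hf ?_), fun i hi => ?_⟩
  · rw [map_zero]
    exact Subtype.ext h
  · exact congrFun (LinearMap.mem_ker.1 hc) ⟨i, hi⟩

section Eigenvalues

variable {H : Type*} [NormedAddCommGroup H] [InnerProductSpace ℝ H] [CompleteSpace H]
variable {G : Type*} [NormedAddCommGroup G] [InnerProductSpace ℝ G] [CompleteSpace G]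

theorem isSymmetric_adjoint_comp (S : H →L[ℝ] G) :
    ((ContinuousLinearMap.adjoint S ∘L S : H →L[ℝ] H) : H →ₗ[ℝ] H).IsSymmetric := by
  intro x y
  simp [ContinuousLinearMap.adjoint_inner_left, ContinuousLinearMap.adjoint_inner_right]

/-- Such an `x` is a finite sum of mutually orthogonal eigenvectors whose images are again
orthogonal, so both squared norms split. -/
theorem le_norm_apply_sq_of_mem_iSup_eigenspace (S : H →L[ℝ] G) {μ : ℝ} {x : H}
    (hx : x ∈ ⨆ ν ∈ Set.Ici μ, Module.End.eigenspace
      ((ContinuousLinearMap.adjoint S ∘L S : H →L[ℝ] H) : H →ₗ[ℝ] H) ν) :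
    μ * ‖x‖ ^ 2 ≤ ‖S x‖ ^ 2 := by
  set W : H →ₗ[ℝ] H := ((ContinuousLinearMap.adjoint S ∘L S : H →L[ℝ] H) : H →ₗ[ℝ] H) with hW
  have hfam := (isSymmetric_adjoint_comp S).orthogonalFamily_eigenspaces
  rw [← hW] at hfam
  rw [iSup_subtype', Submodule.mem_iSup_iff_exists_finsupp] at hx
  obtain ⟨f, hf, rfl⟩ := hx
  have horth : ∀ i j : Set.Ici μ, i ≠ j → ⟪f i, f j⟫_ℝ = 0 := fun i j hij =>
    hfam (fun h => hij (Subtype.ext h)) ⟨f i, hf i⟩ ⟨f j, hf j⟩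
  have hWS : ∀ i y, ⟪S (f i), S y⟫_ℝ = i * ⟪f i, y⟫_ℝ := fun i y => by
    have h1 : W (f i) = (i : ℝ) • f i := Module.End.mem_eigenspace_iff.1 (hf i)
    rw [← real_inner_smul_left, ← h1]
    simp [hW, ContinuousLinearMap.adjoint_inner_left]
  have e1 : ‖∑ i ∈ f.support, f i‖ ^ 2 = ∑ i ∈ f.support, ‖f i‖ ^ 2 := by
    rw [← real_inner_self_eq_norm_sq, sum_inner]
    refine Finset.sum_congr rfl fun i hi => ?_
    rw [inner_sum, Finset.sum_eq_single_of_mem i hi fun j _ hj => horth i j hj.symm,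
      real_inner_self_eq_norm_sq]
  have e2 : ‖S (∑ i ∈ f.support, f i)‖ ^ 2 = ∑ i ∈ f.support, (i : ℝ) * ‖f i‖ ^ 2 := by
    rw [← real_inner_self_eq_norm_sq]
    nth_rw 1 [map_sum]
    rw [sum_inner]
    refine Finset.sum_congr rfl fun i hi => ?_
    rw [hWS, inner_sum, Finset.sum_eq_single_of_mem i hi fun j _ hj => horth i j hj.symm,
      real_inner_self_eq_norm_sq]
  rw [Finsupp.sum, e1, e2, Finset.mul_sum]
  exact Finset.sum_le_sum fun i _ => mul_le_mul_of_nonneg_right i.2 (sq_nonneg _)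

theorem orthonormal_singularVector {S : H →L[ℝ] G} (hS : IsCompactOperator S) {n : ℕ}
    (hn : singularSq S n ≠ 0) :
    Orthonormal ℝ fun i : Fin (n + 1) => singularVector S i := by
  refine ⟨fun i => norm_singularVector hS fun h => hn ?_, fun i j hij => ?_⟩
  · exact le_antisymm (h ▸ singularSq_antitone hS (Nat.lt_succ_iff.1 i.2)) (singularSq_nonneg S n)
  · exact inner_singularVector hS fun h => hij (Fin.ext h.symm)

/-- Courant–Fischer: an `(n + 1)`-dimensional sum of eigenspaces for eigenvalues `≥ μ` meets the
complement of the first `n` singular vectors, which bounds `μ`; the first `n + 1` singular vectors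
show that the bound is attained. The index shifts because the deflation starts at `0`. -/
theorem sqSingularValue_succ {S : H →L[ℝ] G} (hS : IsCompactOperator S) (n : ℕ) :
    sqSingularValue S (n + 1) = singularSq S n := by
  set W : H →L[ℝ] H := ContinuousLinearMap.adjoint S ∘L S with hW
  have hub : ∀ μ ∈ {μ : ℝ | 0 < μ ∧ ((n + 1 : ℕ) : Cardinal) ≤
      Module.rank ℝ ↥(⨆ ν ∈ Set.Ici μ, Module.End.eigenspace (W : H →ₗ[ℝ] H) ν)},
      μ ≤ singularSq S n := by
    rintro μ ⟨-, hμ⟩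
    obtain ⟨x, hxV, hx0, hx⟩ := exists_ne_zero_orthogonal hμ (singularVector S)
    have h1 := le_norm_apply_sq_of_mem_iSup_eigenspace S hxV
    have h2 := norm_apply_sq_le_of_orthogonal hx
    exact le_of_mul_le_mul_right (h1.trans h2) (by positivity)
  refine le_antisymm (Real.sSup_le hub (singularSq_nonneg S n)) ?_
  rcases (singularSq_nonneg S n).eq_or_lt with h0 | hpos
  -- The value `0` is not itself admissible in the supremum, but a supremum of positive numbers, or
  -- of the empty set, is nonnegative.
  · rw [← h0]
    exact Real.sSup_nonneg fun μ hμ => hμ.1.le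
  refine le_csSup ⟨_, hub⟩ ⟨hpos, ?_⟩
  have hmem : ∀ i : Fin (n + 1), singularVector S i ∈
      ⨆ ν ∈ Set.Ici (singularSq S n), Module.End.eigenspace (W : H →ₗ[ℝ] H) ν := fun i => by
    refine Submodule.mem_iSup_of_mem (singularSq S i) (Submodule.mem_iSup_of_mem
      (singularSq_antitone hS (Nat.lt_succ_iff.1 i.2)) ?_)
    rw [Module.End.mem_eigenspace_iff]
    refine ext_inner_right ℝ fun z => ?_
    rw [real_inner_smul_left, ← inner_apply_singularVector hS]
    simp [hW, ContinuousLinearMap.adjoint_inner_left]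
  have hli := (orthonormal_singularVector hS hpos.ne').linearIndependent
  refine Module.le_rank_iff.2 ⟨fun i => ⟨singularVector S i, hmem i⟩, ?_⟩
  exact LinearIndependent.of_comp (Submodule.subtype _) hli

end Eigenvalues

/-! ### Simple tensors and the action of the tensor power operator on them. -/

section SimpleTensors

variable {H : Type*} [NormedAddCommGroup H] [InnerProductSpace ℝ H]
variable {G : Type*} [NormedAddCommGroup G] [InnerProductSpace ℝ G]

/-- The simple tensor `f₁ ⊗ ⋯ ⊗ f_d` in the algebraic tensor power. -/
noncomputable def algTensor {d : ℕ} (f : Fin d → H) : AlgTensorPow H d :=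
  (PiTensorProduct.tprod ℝ f : ⨂[ℝ] _ : Fin d, H)

/-- The simple tensor `f₁ ⊗ ⋯ ⊗ f_d` in the Hilbert space tensor power. -/
noncomputable def hilbertTensor {d : ℕ} (f : Fin d → H) : HilbertTensorPow H d :=
  (algTensor f : UniformSpace.Completion (AlgTensorPow H d))

theorem inner_algTensor {d : ℕ} (f g : Fin d → H) :
    ⟪algTensor f, algTensor g⟫_ℝ = ∏ k, ⟪f k, g k⟫_ℝ :=
  tensorForm_tprod f g

theorem inner_hilbertTensor {d : ℕ} (f g : Fin d → H) :
    ⟪hilbertTensor f, hilbertTensor g⟫_ℝ = ∏ k, ⟪f k, g k⟫_ℝ := by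
  rw [hilbertTensor, hilbertTensor, UniformSpace.Completion.inner_coe, inner_algTensor]

theorem algTensorPowMap_algTensor [CompleteSpace G] (S : H →L[ℝ] G) {d : ℕ} (f : Fin d → H) :
    algTensorPowMap S d (algTensor f) = algTensor fun k => S (f k) :=
  PiTensorProduct.map_tprod _ f

theorem tensorPowMap_coe [CompleteSpace G] (S : H →L[ℝ] G) {d : ℕ} (x : AlgTensorPow H d) :
    tensorPowMap S d (x : UniformSpace.Completion (AlgTensorPow H d))
      = (algTensorPowMap S d x : UniformSpace.Completion (AlgTensorPow G d)) := by
  simp [tensorPowMap]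

theorem tensorPowMap_hilbertTensor [CompleteSpace G] (S : H →L[ℝ] G) {d : ℕ} (f : Fin d → H) :
    tensorPowMap S d (hilbertTensor f) = hilbertTensor fun k => S (f k) := by
  rw [hilbertTensor, tensorPowMap_coe, algTensorPowMap_algTensor]
  rfl

theorem norm_tensorPowMap_apply_le [CompleteSpace G] (S : H →L[ℝ] G) {d : ℕ}
    (x : HilbertTensorPow H d) : ‖tensorPowMap S d x‖ ≤ ‖S‖ ^ d * ‖x‖ := by
  induction x using UniformSpace.Completion.induction_on with
  | hp => exact isClosed_le (by fun_prop) (by fun_prop)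
  | ih x =>
    rw [tensorPowMap_coe, UniformSpace.Completion.norm_coe, UniformSpace.Completion.norm_coe]
    exact norm_map_le S x

theorem prod_inner_eq_zero {ι : Type*} {d : ℕ} {b : ι → H}
    (hb : ∀ i j, i ≠ j → ⟪b i, b j⟫_ℝ = 0) {p q : Fin d → ι} (hpq : p ≠ q) :
    ∏ k, ⟪b (p k), b (q k)⟫_ℝ = 0 := by
  obtain ⟨k, hk⟩ := Function.ne_iff.1 hpq
  exact Finset.prod_eq_zero (Finset.mem_univ k) (hb _ _ hk)

theorem norm_sq_sum_smul_of_orthogonal {ι : Type*} (s : Finset ι) (v : ι → H) (c : ι → ℝ)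
    (hv : ∀ i ∈ s, ∀ j ∈ s, i ≠ j → ⟪v i, v j⟫_ℝ = 0) :
    ‖∑ i ∈ s, c i • v i‖ ^ 2 = ∑ i ∈ s, c i ^ 2 * ‖v i‖ ^ 2 := by
  rw [← real_inner_self_eq_norm_sq, sum_inner]
  refine Finset.sum_congr rfl fun i hi => ?_
  rw [inner_sum, Finset.sum_eq_single_of_mem i hi fun j hj hji => by
      rw [real_inner_smul_left, real_inner_smul_right, hv i hi j hj hji.symm, mul_zero, mul_zero],
    real_inner_smul_left, real_inner_smul_right, real_inner_self_eq_norm_sq]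
  ring

theorem norm_algTensor_sq {d : ℕ} (f : Fin d → H) : ‖algTensor f‖ ^ 2 = ∏ k, ‖f k‖ ^ 2 := by
  rw [← real_inner_self_eq_norm_sq, inner_algTensor]
  exact Finset.prod_congr rfl fun k _ => real_inner_self_eq_norm_sq _

theorem norm_hilbertTensor_sq {d : ℕ} (f : Fin d → H) :
    ‖hilbertTensor f‖ ^ 2 = ∏ k, ‖f k‖ ^ 2 := by
  rw [hilbertTensor, UniformSpace.Completion.norm_coe, norm_algTensor_sq]

theorem exists_sum_smul_tprod {m d : ℕ} (b : Fin m → H) {V : Submodule ℝ H}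
    (hV : V ≤ Submodule.span ℝ (Set.range b)) {x : ⨂[ℝ] _ : Fin d, H}
    (hx : x ∈ Submodule.span ℝ (PiTensorProduct.tprod ℝ '' {f : Fin d → H | ∀ k, f k ∈ V})) :
    ∃ c : (Fin d → Fin m) → ℝ, x = ∑ q, c q • PiTensorProduct.tprod ℝ fun k => b (q k) := by
  have hspan : x ∈ Submodule.span ℝ (Set.range fun p : Fin d → Fin m =>
      PiTensorProduct.tprod ℝ (fun k => b (p k))) := by
    refine Submodule.span_le.2 ?_ hx
    rintro _ ⟨f, hf, rfl⟩
    have hfk : ∀ k, ∃ a : Fin m → ℝ, ∑ i, a i • b i = f k := fun k =>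
      (Submodule.mem_span_range_iff_exists_fun ℝ).1 (hV (hf k))
    choose a ha using hfk
    rw [← funext ha, MultilinearMap.map_sum]
    refine Submodule.sum_mem _ fun p _ => ?_
    rw [MultilinearMap.map_smul_univ]
    exact Submodule.smul_mem _ _ (Submodule.subset_span ⟨p, rfl⟩)
  obtain ⟨c, hc⟩ := (Submodule.mem_span_range_iff_exists_fun ℝ).1 hspan
  exact ⟨c, hc.symm⟩

end SimpleTensors

/-! ### Orthonormal systems adapted to the singular vectors. -/

section Expansion

variable {H : Type*} [NormedAddCommGroup H] [InnerProductSpace ℝ H] [CompleteSpace H]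
variable {G : Type*} [NormedAddCommGroup G] [InnerProductSpace ℝ G] [CompleteSpace G]

/-- A finite-dimensional space has an orthonormal basis which an operator maps to orthogonal
vectors. -/
theorem exists_orthonormal_span_eq (T : H →L[ℝ] G) (U : Submodule ℝ H) [FiniteDimensional ℝ U] :
    ∃ (m : ℕ) (u : Fin m → H), Orthonormal ℝ u ∧ (∀ i j, i ≠ j → ⟪T (u i), T (u j)⟫_ℝ = 0) ∧
      Submodule.span ℝ (Set.range u) = U := by
  let TU : U →L[ℝ] G := T ∘L U.subtypeL
  -- An eigenbasis of `TU† TU` on `U` is orthonormal and has orthogonal images.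
  have hA := isSymmetric_adjoint_comp TU
  let e := hA.eigenvectorBasis rfl
  refine ⟨Module.finrank ℝ U, fun i => (e i : H), e.orthonormal.comp_linearIsometry U.subtypeₗᵢ,
    fun i j hij => ?_, ?_⟩
  · have h1 : ⟪T (e i), T (e j)⟫_ℝ = ⟪(ContinuousLinearMap.adjoint TU ∘L TU) (e i), e j⟫_ℝ := by
      simp [TU, ContinuousLinearMap.adjoint_inner_left]
    have h2 : (ContinuousLinearMap.adjoint TU ∘L TU) (e i) = (hA.eigenvalues rfl i) • e i :=
      hA.apply_eigenvectorBasis rfl i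
    rw [h1, h2, inner_smul_left, e.orthonormal.2 hij, mul_zero]
  · have h := e.toBasis.span_eq
    rw [OrthonormalBasis.coe_toBasis] at h
    have h3 := congrArg (Submodule.map U.subtype) h
    rw [Submodule.map_span, ← Set.range_comp, Submodule.map_subtype_top] at h3
    exact h3

/-- A finite-dimensional space is contained in the span of an orthonormal system which consists of
the first `n` singular vectors and of vectors orthogonal to them. -/
theorem exists_orthonormal_extension {S : H →L[ℝ] G} (hS : IsCompactOperator S) {n : ℕ}
    (hn : ∀ i < n, singularSq S i ≠ 0) (V : Submodule ℝ H) [FiniteDimensional ℝ V] :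
    ∃ (m : ℕ) (b : Fin m → H), Orthonormal ℝ b ∧ (∀ i j, i ≠ j → ⟪S (b i), S (b j)⟫_ℝ = 0) ∧
      V ≤ Submodule.span ℝ (Set.range b) ∧ (∀ i : Fin m, (i : ℕ) < n → b i = singularVector S i) ∧
      ∀ i : Fin m, n ≤ i → ∀ j < n, ⟪singularVector S j, b i⟫_ℝ = 0 := by
  -- `Q` projects onto the complement of the first `n` singular vectors. An adapted basis of `Q V`,
  -- appended to these vectors, is the required system.
  let Q : H →ₗ[ℝ] H := LinearMap.id -
    ∑ i : Fin n, (innerₗ H (singularVector S i)).smulRight (singularVector S i)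
  have hQ : ∀ x, Q x = x - ∑ i : Fin n, ⟪singularVector S i, x⟫_ℝ • singularVector S i := fun x => by
    simp [Q]
  have hQo : ∀ x, ∀ j < n, ⟪singularVector S j, Q x⟫_ℝ = 0 := fun x j hj => by
    rw [hQ, inner_sub_right, inner_sum, Finset.sum_eq_single (⟨j, hj⟩ : Fin n), inner_smul_right,
      real_inner_self_eq_norm_sq, norm_singularVector hS (hn j hj)]
    · simp
    · intro i _ hij
      rw [inner_smul_right, inner_singularVector hS fun h => hij (Fin.ext h), mul_zero]
    · simp
  obtain ⟨m, u, hu, hSu, hspan⟩ := exists_orthonormal_span_eq S (V.map Q)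
  have huo : ∀ i, ∀ j < n, ⟪singularVector S j, u i⟫_ℝ = 0 := fun i j hj => by
    have hmem : u i ∈ V.map Q := hspan ▸ Submodule.subset_span ⟨i, rfl⟩
    obtain ⟨x, -, hx⟩ := hmem
    rw [← hx, hQo x j hj]
  have hb : ∀ i j, i ≠ j → ⟪Fin.append (fun i : Fin n => singularVector S i) u i,
      Fin.append (fun i : Fin n => singularVector S i) u j⟫_ℝ = 0 := by
    intro i j
    refine Fin.addCases (fun i => ?_) (fun i => ?_) i <;>
      refine Fin.addCases (fun j => ?_) (fun j => ?_) j <;> intro hij <;>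
      simp only [Fin.append_left, Fin.append_right]
    · exact inner_singularVector hS fun h => hij (by rw [Fin.ext h])
    · exact huo j i i.2
    · rw [real_inner_comm]
      exact huo i j j.2
    · exact hu.2 fun h => hij (by rw [h])
  refine ⟨n + m, Fin.append (fun i : Fin n => singularVector S i) u, ⟨fun i => ?_, fun i j => hb i j⟩,
    fun i j => ?_, fun x hx => ?_, fun i hi => ?_, fun i hi j hj => ?_⟩
  · refine Fin.addCases (fun i => ?_) (fun i => ?_) i
    · simpa using norm_singularVector hS (hn i i.2)
    · simpa using hu.1 i
  · refine Fin.addCases (fun i => ?_) (fun i => ?_) i <;>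
      refine Fin.addCases (fun j => ?_) (fun j => ?_) j <;> intro hij <;>
      have h0 := hb _ _ hij <;>
      simp only [Fin.append_left, Fin.append_right] at h0 ⊢
    · rw [inner_apply_singularVector hS, h0, mul_zero]
    · rw [inner_apply_singularVector hS, h0, mul_zero]
    · rw [real_inner_comm, inner_apply_singularVector hS, real_inner_comm, h0, mul_zero]
    · exact hSu i j fun h => hij (by rw [h])
  · have h1 : x = ∑ i : Fin n, ⟪singularVector S i, x⟫_ℝ • singularVector S i + Q x := by
      rw [hQ]
      abel
    rw [h1]
    refine Submodule.add_mem _ (Submodule.sum_mem _ fun i _ => Submodule.smul_mem _ _ ?_) ?_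
    · exact Submodule.subset_span ⟨Fin.castAdd m i, by simp⟩
    · have h2 : Q x ∈ Submodule.span ℝ (Set.range u) := by
        rw [hspan]
        exact Submodule.mem_map_of_mem hx
      refine Submodule.span_mono ?_ h2
      rintro _ ⟨i, rfl⟩
      exact ⟨Fin.natAdd n i, by simp⟩
  · obtain ⟨i', rfl⟩ : ∃ i' : Fin n, i = Fin.castAdd m i' := ⟨⟨i, hi⟩, rfl⟩
    simp
  · obtain ⟨i', rfl⟩ : ∃ i' : Fin m, i = Fin.natAdd n i' :=
      ⟨⟨i - n, by omega⟩, Fin.ext (by simp; omega)⟩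
    simpa using huo i' j hj

end Expansion

/-- The multi-indices `p` with `τ < ν (p 1) ⋯ ν (p d)`. -/
def largeIndices (ν : ℕ → ℝ) (d : ℕ) (τ : ℝ) : Set (Fin d → ℕ) := {p | τ < ∏ k, ν (p k)}

theorem prod_le_mul_max_pow {ν : ℕ → ℝ} (h0 : ∀ n, 0 ≤ ν n) (hν : Antitone ν) {d : ℕ}
    (p : Fin d → ℕ) (k : Fin d) : ∏ i, ν (p i) ≤ ν (p k) * max (ν 0) 1 ^ d := by
  rw [← Finset.mul_prod_erase Finset.univ (fun i => ν (p i)) (Finset.mem_univ k)]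
  refine mul_le_mul_of_nonneg_left ?_ (h0 _)
  calc ∏ i ∈ Finset.univ.erase k, ν (p i)
      ≤ ∏ _i ∈ Finset.univ.erase k, max (ν 0) 1 :=
        Finset.prod_le_prod (fun i _ => h0 _)
          fun i _ => (hν (Nat.zero_le _)).trans (le_max_left _ _)
    _ ≤ max (ν 0) 1 ^ d := by
        rw [Finset.prod_const]
        refine pow_le_pow_right₀ (le_max_right _ _) ?_
        simp

/-- All other factors together are at most `max (ν 0) 1 ^ d`, so one sufficiently small factor
already pushes the product below `τ`; hence the entries are bounded. -/
theorem finite_largeIndices {ν : ℕ → ℝ} (h0 : ∀ n, 0 ≤ ν n) (hν : Antitone ν)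
    (hlim : Tendsto ν atTop (𝓝 0)) (d : ℕ) {τ : ℝ} (hτ : 0 < τ) : (largeIndices ν d τ).Finite := by
  have hM : 0 < max (ν 0) 1 ^ d := pow_pos (lt_max_of_lt_right one_pos) d
  obtain ⟨N, hN⟩ := ((tendsto_order.1 hlim).2 (τ / max (ν 0) 1 ^ d) (by positivity)).exists
  refine (Set.Finite.pi' fun _ : Fin d => Set.finite_Iio N).subset fun p hp k => ?_
  by_contra hk
  have h1 : ν (p k) < τ / max (ν 0) 1 ^ d := (hν (by simpa using hk)).trans_lt hN
  rw [lt_div_iff₀ hM] at h1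
  exact absurd (prod_le_mul_max_pow h0 hν p k) (not_le.2 (h1.trans hp))

/-! ### Error of the truncated singular expansion. -/

section Approximation

variable {H : Type*} [NormedAddCommGroup H] [InnerProductSpace ℝ H] [CompleteSpace H]
variable {G : Type*} [NormedAddCommGroup G] [InnerProductSpace ℝ G] [CompleteSpace G]

/-- On a product of adapted basis vectors, the truncation is exact if the multi-index lies in `J`
and gives zero otherwise. -/
theorem algTensorPowMap_sub_apply {S : H →L[ℝ] G} (hS : IsCompactOperator S)
    {n m d : ℕ} {b : Fin m → H} (hb : Orthonormal ℝ b)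
    (hbn : ∀ i : Fin m, (i : ℕ) < n → b i = singularVector S i)
    (hbo : ∀ i : Fin m, n ≤ i → ∀ j < n, ⟪singularVector S j, b i⟫_ℝ = 0)
    (J : Finset (Fin d → ℕ)) (hJ : ∀ p ∈ J, ∀ k, p k < n) (q : Fin d → Fin m) :
    algTensorPowMap S d (algTensor fun k => b (q k)) -
      ∑ p ∈ J, ⟪algTensor fun k => singularVector S (p k), algTensor fun k => b (q k)⟫_ℝ •
        algTensor (fun k => S (singularVector S (p k)))
      = (if (fun k => (q k : ℕ)) ∈ J then 0 else 1 : ℝ) • algTensor fun k => S (b (q k)) := by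
  rw [algTensorPowMap_algTensor]
  have hzero : ∀ p ∈ J, p ≠ (fun k => (q k : ℕ)) →
      ⟪algTensor fun k => singularVector S (p k), algTensor fun k => b (q k)⟫_ℝ = 0 := by
    intro p hp hpq
    obtain ⟨k, hk⟩ := Function.ne_iff.1 hpq
    rw [inner_algTensor]
    refine Finset.prod_eq_zero (Finset.mem_univ k) ?_
    rcases lt_or_ge (q k : ℕ) n with h | h
    · rw [hbn _ h]
      exact inner_singularVector hS (Ne.symm hk)
    · exact hbo _ h _ (hJ p hp k)
  split_ifs with hq
  · rw [Finset.sum_eq_single_of_mem _ hq fun p hp hpq => by rw [hzero p hp hpq, zero_smul]]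
    have h1 : (fun k => singularVector S (q k : ℕ)) = fun k => b (q k) :=
      funext fun k => (hbn _ (hJ _ hq k)).symm
    have h2 : (fun k => S (singularVector S (q k : ℕ))) = fun k => S (b (q k)) :=
      funext fun k => by rw [hbn _ (hJ _ hq k)]
    rw [h1, h2, inner_algTensor, Finset.prod_eq_one fun k _ => by
      rw [real_inner_self_eq_norm_sq, hb.1, one_pow], one_smul, sub_self, zero_smul]
  · rw [Finset.sum_eq_zero fun p hp => by
      rw [hzero p hp fun h => hq (h ▸ hp), zero_smul], sub_zero, one_smul]

/-- A given tensor involves only a finite-dimensional subspace of `H`, so it expands in products of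
an adapted basis. The error is then an orthogonal sum over the multi-indices outside `J`, and no
complete singular basis of `H` is needed. -/
theorem norm_algTensorPowMap_sub_sq_le {S : H →L[ℝ] G} (hS : IsCompactOperator S) {n d : ℕ}
    (hn : ∀ i < n, singularSq S i ≠ 0) (J : Finset (Fin d → ℕ)) (hJ : ∀ p ∈ J, ∀ k, p k < n)
    {τ : ℝ} (hτ0 : 0 ≤ τ) (hτ : ∀ p ∉ J, ∏ k, singularSq S (p k) ≤ τ) (x : AlgTensorPow H d) :
    ‖algTensorPowMap S d x - ∑ p ∈ J, ⟪algTensor fun k => singularVector S (p k), x⟫_ℝ •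
        algTensor (fun k => S (singularVector S (p k)))‖ ^ 2 ≤ τ * ‖x‖ ^ 2 := by
  obtain ⟨V, hV, hxV⟩ := exists_finiteDimensional_span (d := d) x
  obtain ⟨m, b, hb, hSb, hVb, hbn, hbo⟩ := exists_orthonormal_extension hS hn V
  obtain ⟨c, hc⟩ := exists_sum_smul_tprod b hVb hxV
  replace hc : x = ∑ q, c q • algTensor fun k => b (q k) := hc
  have hdiff : algTensorPowMap S d x - ∑ p ∈ J, ⟪algTensor fun k => singularVector S (p k), x⟫_ℝ •
        algTensor (fun k => S (singularVector S (p k)))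
      = ∑ q : Fin d → Fin m, (c q * (if (fun k => (q k : ℕ)) ∈ J then 0 else 1 : ℝ)) •
          algTensor fun k => S (b (q k)) := by
    simp_rw [mul_smul, ← algTensorPowMap_sub_apply hS hb hbn hbo J hJ, smul_sub, Finset.smul_sum,
      Finset.sum_sub_distrib]
    rw [Finset.sum_comm, hc, map_sum]
    simp_rw [map_smul, inner_sum, inner_smul_right, Finset.sum_smul, mul_smul]
  rw [hdiff, hc, norm_sq_sum_smul_of_orthogonal, norm_sq_sum_smul_of_orthogonal, Finset.mul_sum]
  · refine Finset.sum_le_sum fun q _ => ?_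
    have hb1 : ∏ k, ‖b (q k)‖ ^ 2 = 1 := Finset.prod_eq_one fun k _ => by rw [hb.1, one_pow]
    rw [norm_algTensor_sq, norm_algTensor_sq, hb1, mul_one]
    split_ifs with hq
    · rw [mul_zero, zero_pow two_ne_zero, zero_mul]
      positivity
    · rw [mul_one, mul_comm]
      refine mul_le_mul_of_nonneg_right ?_ (sq_nonneg _)
      -- Basis vectors with index `≥ n` are orthogonal to the first `n` singular vectors, so each is
      -- stretched by at most `singularSq S n`. Capping the entries at `n` keeps the multi-index
      -- outside `J`, whose entries are all below `n`.
      refine le_trans (Finset.prod_le_prod (fun k _ => sq_nonneg _) fun k _ => ?_)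
        (hτ (fun k => min (q k : ℕ) n) fun hmem => hq ?_)
      · rcases lt_or_ge (q k : ℕ) n with h | h
        · rw [hbn _ h, norm_apply_singularVector_sq hS, min_eq_left h.le]
        · rw [min_eq_right h]
          simpa [hb.1] using norm_apply_sq_le_of_orthogonal (hbo (q k) h)
      · convert hmem using 2 with k
        have := hJ _ hmem k
        omega
  · intro p _ q _ hpq
    rw [inner_algTensor]
    exact prod_inner_eq_zero (fun i j hij => hb.2 hij) hpq
  · intro p _ q _ hpq
    rw [inner_algTensor]
    exact prod_inner_eq_zero hSb hpq

theorem norm_tensorPowMap_sub_sq_le {S : H →L[ℝ] G} (hS : IsCompactOperator S) {n d : ℕ}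
    (hn : ∀ i < n, singularSq S i ≠ 0) (J : Finset (Fin d → ℕ)) (hJ : ∀ p ∈ J, ∀ k, p k < n)
    {τ : ℝ} (hτ0 : 0 ≤ τ) (hτ : ∀ p ∉ J, ∏ k, singularSq S (p k) ≤ τ) (x : HilbertTensorPow H d) :
    ‖tensorPowMap S d x - ∑ p ∈ J, ⟪hilbertTensor fun k => singularVector S (p k), x⟫_ℝ •
        hilbertTensor (fun k => S (singularVector S (p k)))‖ ^ 2 ≤ τ * ‖x‖ ^ 2 := by
  induction x using UniformSpace.Completion.induction_on with
  | hp => exact isClosed_le (by fun_prop) (by fun_prop)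
  | ih x =>
    have h := norm_algTensorPowMap_sub_sq_le hS hn J hJ hτ0 hτ x
    rw [← UniformSpace.Completion.norm_coe, ← UniformSpace.Completion.norm_coe x,
      UniformSpace.Completion.coe_sub] at h
    have hsum : ((∑ p ∈ J, ⟪algTensor fun k => singularVector S (p k), x⟫_ℝ •
        algTensor (fun k => S (singularVector S (p k))) : AlgTensorPow G d) :
          UniformSpace.Completion (AlgTensorPow G d))
        = ∑ p ∈ J, ⟪hilbertTensor fun k => singularVector S (p k), x⟫_ℝ •
          hilbertTensor (fun k => S (singularVector S (p k))) := by
      simp_rw [hilbertTensor, UniformSpace.Completion.inner_coe]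
      refine (map_sum (UniformSpace.Completion.toComplₗᵢ (𝕜 := ℝ) (E := AlgTensorPow G d)) _ _).trans
        (Finset.sum_congr rfl fun p _ => ?_)
      exact UniformSpace.Completion.coe_smul _ _
    rwa [hsum, ← tensorPowMap_coe] at h

end Approximation

/-! ### Worst case errors and the operator norm. -/

section WorstCase

variable {F G : Type*} [NormedAddCommGroup F] [NormedSpace ℝ F]
  [NormedAddCommGroup G] [NormedSpace ℝ G]

theorem IsLinearAlgorithm.map_smul {n : ℕ} {A : F → G} (hA : IsLinearAlgorithm n A) (c : ℝ)
    (f : F) : A (c • f) = c • A f := by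
  obtain ⟨L, g, h⟩ := hA
  simp [h, Finset.smul_sum, mul_smul]

theorem worstCaseError_le_iff {n : ℕ} {A : F → G} (hA : IsLinearAlgorithm n A) (S : F →L[ℝ] G)
    {ε : ℝ} (hε : 0 ≤ ε) :
    worstCaseError S A ≤ ENNReal.ofReal ε ↔ ∀ f, ‖S f - A f‖ ≤ ε * ‖f‖ := by
  have h1 : worstCaseError S A ≤ ENNReal.ofReal ε ↔ ∀ f, ‖f‖ ≤ 1 → ‖S f - A f‖ ≤ ε := by
    simp only [worstCaseError, iSup_le_iff, mem_closedBall_zero_iff, ← ofReal_norm,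
      ENNReal.ofReal_le_ofReal_iff hε]
  rw [h1]
  refine ⟨fun h f => ?_, fun h f hf => (h f).trans (mul_le_of_le_one_right hε hf)⟩
  rcases eq_or_ne f 0 with rfl | hf
  · have := hA.map_smul 0 0
    simp_all
  · have hf' : 0 < ‖f‖ := norm_pos_iff.2 hf
    have h2 := h (‖f‖⁻¹ • f) (by rw [norm_smul, norm_inv, norm_norm, inv_mul_cancel₀ hf'.ne'])
    rw [hA.map_smul, _root_.map_smul, ← smul_sub, norm_smul, norm_inv, norm_norm,
      inv_mul_le_iff₀ hf'] at h2
    linarith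

theorem initialError_eq_opNorm (S : F →L[ℝ] G) : initialError S = ‖S‖ := by
  have hA : IsLinearAlgorithm 0 (0 : F → G) := ⟨Fin.elim0, Fin.elim0, fun f => by simp⟩
  have h1 : minimalError S 0 = worstCaseError S 0 := by
    refine le_antisymm (iInf₂_le _ hA) (le_iInf₂ fun A hA' => ?_)
    obtain ⟨L, g, h⟩ := hA'
    have : A = 0 := funext fun f => by simp [h]
    rw [this]
  have h2 : worstCaseError S 0 = ENNReal.ofReal ‖S‖ := by
    refine le_antisymm ((worstCaseError_le_iff hA S (norm_nonneg S)).2 fun f => ?_) ?_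
    · simpa using S.le_opNorm f
    · have hfin : worstCaseError S 0 ≠ ⊤ := ne_top_of_le_ne_top ENNReal.ofReal_ne_top
        ((worstCaseError_le_iff hA S (norm_nonneg S)).2 fun f => by simpa using S.le_opNorm f)
      rw [← ENNReal.ofReal_toReal hfin]
      refine ENNReal.ofReal_le_ofReal (S.opNorm_le_bound ENNReal.toReal_nonneg fun f => ?_)
      have h3 := (worstCaseError_le_iff hA S (ε := (worstCaseError S 0).toReal)
        ENNReal.toReal_nonneg).1 (by rw [ENNReal.ofReal_toReal hfin]) f
      simpa using h3
  rw [initialError, h1, h2, ENNReal.toReal_ofReal (norm_nonneg S)]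

end WorstCase

/-! ### Exact information complexity and initial error of the scaled tensor problem. -/

section Complexity

variable {H : Type*} [NormedAddCommGroup H] [InnerProductSpace ℝ H] [CompleteSpace H]
variable {G : Type*} [NormedAddCommGroup G] [InnerProductSpace ℝ G] [CompleteSpace G]

theorem scaledOp_apply {E : Type*} [NormedAddCommGroup E] [InnerProductSpace ℝ E] {G : Type*}
    [NormedAddCommGroup G] [InnerProductSpace ℝ G] (c : {x : ℝ // 0 < x}) (T : E →L[ℝ] G)
    (x : ScaledSpace c E) : scaledOp c T x = T (ScaledSpace.toBase c E x) := rfl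

theorem exists_isLinearAlgorithm_scaledOp {E : Type*} [NormedAddCommGroup E]
    [InnerProductSpace ℝ E] {G : Type*} [NormedAddCommGroup G] [InnerProductSpace ℝ G]
    (c : {x : ℝ // 0 < x}) (T : E →L[ℝ] G) {ι : Type*} (J : Finset ι) (e : ι → E) (g : ι → G)
    {ε : ℝ} (hε : 0 ≤ ε)
    (h : ∀ x, ‖T x - ∑ p ∈ J, ⟪e p, x⟫_ℝ • g p‖ ^ 2 ≤ ε ^ 2 / c * ‖x‖ ^ 2) :
    ∃ A : ScaledSpace c E → G, IsLinearAlgorithm J.card A ∧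
      worstCaseError (scaledOp c T) A ≤ ENNReal.ofReal ε := by
  have hA : IsLinearAlgorithm (F := ScaledSpace c E) J.card
      fun x => ∑ p ∈ J, ⟪e p, ScaledSpace.toBase c E x⟫_ℝ • g p := by
    refine ⟨fun j => scaledOp c (innerSL ℝ (e (J.equivFin.symm j))),
      fun j => g (J.equivFin.symm j), fun f => ?_⟩
    simp only [scaledOp_apply, innerSL_apply_apply]
    rw [Equiv.sum_comp J.equivFin.symm
      fun p : J => ⟪e p, ScaledSpace.toBase c E f⟫_ℝ • g p]
    exact (Finset.sum_coe_sort J fun p => ⟪e p, ScaledSpace.toBase c E f⟫_ℝ • g p).symm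
  refine ⟨_, hA, (worstCaseError_le_iff hA _ hε).2 fun f => ?_⟩
  refine abs_le_of_sq_le_sq' ?_ (by positivity) |>.2
  rw [mul_pow, scaledSpace_norm_sq, ← mul_assoc, ← div_eq_mul_inv]
  exact h (ScaledSpace.toBase c E f)

/-- With fewer than `J.card` functionals, some nonzero combination of the singular tensors in `J` is
invisible to all of them. The algorithm returns `0` there, while the operator stretches this
combination by more than the error bound permits. -/
theorem card_le_of_worstCaseError_le {S : H →L[ℝ] G} (hS : IsCompactOperator S)
    (c : {x : ℝ // 0 < x}) {d : ℕ} (J : Finset (Fin d → ℕ)) {ε : ℝ} (hε : 0 ≤ ε)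
    (hJ : ∀ p ∈ J, ε ^ 2 / c < ∏ k, singularSq S (p k)) {n : ℕ}
    {A : ScaledSpace c (HilbertTensorPow H d) → HilbertTensorPow G d} (hA : IsLinearAlgorithm n A)
    (hw : worstCaseError (scaledOp c (tensorPowMap S d)) A ≤ ENNReal.ofReal ε) : J.card ≤ n := by
  by_contra! hcard
  rw [worstCaseError_le_iff hA _ hε] at hw
  obtain ⟨L, g, hL⟩ := hA
  let e : (Fin d → ℕ) → HilbertTensorPow H d := fun p =>
    hilbertTensor fun k => singularVector S (p k)
  let φ : (J → ℝ) →ₗ[ℝ] HilbertTensorPow H d := Fintype.linearCombination ℝ fun p : J => e p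
  let toS : HilbertTensorPow H d →ₗ[ℝ] ScaledSpace c (HilbertTensorPow H d) := LinearMap.id
  let ψ : (J → ℝ) →ₗ[ℝ] (Fin n → ℝ) := LinearMap.pi fun i => (L i : _ →ₗ[ℝ] ℝ) ∘ₗ toS ∘ₗ φ
  obtain ⟨a, ha, ha0⟩ := Submodule.exists_mem_ne_zero_of_ne_bot
    (ψ.ker_ne_bot_of_finrank_lt (by simpa using hcard))
  have hLa : ∀ i, L i (toS (φ a)) = 0 := fun i => congrFun (LinearMap.mem_ker.1 ha) i
  have hw' := hw (toS (φ a))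
  have hφ : φ a = ∑ p : J, a p • e p := Fintype.linearCombination_apply ℝ _ a
  have hpos : ∀ p : J, ∀ k, singularSq S (p.1 k) ≠ 0 := fun p k h0 => by
    have h1 := hJ p p.2
    rw [Finset.prod_eq_zero (Finset.mem_univ k) h0] at h1
    have := c.2
    exact absurd h1 (not_lt.2 (by positivity))
  have he : ∀ p : J, ‖e p‖ ^ 2 = 1 := fun p => by
    simp only [e]
    rw [norm_hilbertTensor_sq]
    exact Finset.prod_eq_one fun k _ => by rw [norm_singularVector hS (hpos p k), one_pow]
  have hne : ∀ p q : J, p ≠ q → (p : Fin d → ℕ) ≠ q := fun p q h h' => h (Subtype.ext h')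
  have hn1 : ‖φ a‖ ^ 2 = ∑ p : J, a p ^ 2 := by
    rw [hφ, norm_sq_sum_smul_of_orthogonal _ _ _ fun p _ q _ hpq => ?_]
    · simp [he]
    · rw [inner_hilbertTensor]
      exact prod_inner_eq_zero (fun i j hij => inner_singularVector hS hij.symm) (hne p q hpq)
  have hn2 : ‖tensorPowMap S d (φ a)‖ ^ 2 = ∑ p : J, a p ^ 2 * ∏ k, singularSq S (p.1 k) := by
    simp only [hφ, map_sum, map_smul, e, tensorPowMap_hilbertTensor]
    rw [norm_sq_sum_smul_of_orthogonal _ _ _ fun p _ q _ hpq => ?_]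
    · simp [norm_hilbertTensor_sq, norm_apply_singularVector_sq hS]
    · rw [inner_hilbertTensor]
      refine prod_inner_eq_zero (b := fun i => S (singularVector S i)) (fun i j hij => ?_)
        (hne p q hpq)
      rw [inner_apply_singularVector hS, inner_singularVector hS hij.symm, mul_zero]
  have h3 : ‖tensorPowMap S d (φ a)‖ ^ 2 ≤ ε ^ 2 / c * ‖φ a‖ ^ 2 := by
    rw [hL, Finset.sum_eq_zero fun i _ => by rw [hLa, zero_smul], sub_zero] at hw'
    have h4 : ‖tensorPowMap S d (φ a)‖ ^ 2 ≤ (ε * ‖toS (φ a)‖) ^ 2 :=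
      pow_le_pow_left₀ (norm_nonneg _) hw' 2
    rw [mul_pow, scaledSpace_norm_sq, ← mul_assoc, ← div_eq_mul_inv] at h4
    exact h4
  rw [hn1, hn2, Finset.mul_sum] at h3
  refine absurd h3 (not_le.2 (Finset.sum_lt_sum (fun p _ => ?_) ?_))
  · rw [mul_comm]
    exact mul_le_mul_of_nonneg_left (hJ p p.2).le (sq_nonneg _)
  · obtain ⟨p, hp⟩ := Function.ne_iff.1 ha0
    refine ⟨p, Finset.mem_univ p, ?_⟩
    rw [mul_comm]
    exact mul_lt_mul_of_pos_left (hJ p p.2) (by have : a p ≠ 0 := hp; positivity)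

theorem infoComplexity_scaledTensorProblem {S : H →L[ℝ] G} (hS : IsCompactOperator S)
    (hS0 : singularSq S 0 ≠ 0) (s : ℕ → {x : ℝ // 0 < x}) (d : ℕ) {ε : ℝ} (hε : 0 < ε) :
    infoComplexity (scaledTensorProblem S s d) ε
      = (largeIndices (singularSq S) d (ε ^ 2 / s d)).ncard := by
  have hsd := (s d).2
  have hτ : 0 < ε ^ 2 / (s d : ℝ) := by positivity
  have hfin := finite_largeIndices (singularSq_nonneg S) (singularSq_antitone hS)
    (tendsto_singularSq hS) d hτ
  rw [Set.ncard_eq_toFinset_card _ hfin]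
  set J := hfin.toFinset with hJdef
  have hJ : ∀ p, p ∈ J ↔ ε ^ 2 / (s d : ℝ) < ∏ k, singularSq S (p k) := fun p => by
    simp [hJdef, largeIndices]
  -- One more than the largest entry in `J`: the singular values below `n` are then nonzero, because
  -- that entry occurs in a positive product. If only index `0` occurs, `hS0` is used.
  let n := J.sup (fun p => Finset.univ.sup fun k => p k) + 1
  have hJn : ∀ p ∈ J, ∀ k, p k < n := fun p hp k => by
    have h1 : p k ≤ Finset.univ.sup p := Finset.le_sup (Finset.mem_univ k)
    have h2 : Finset.univ.sup p ≤ J.sup (fun p => Finset.univ.sup fun k => p k) :=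
      Finset.le_sup (f := fun p : Fin d → ℕ => Finset.univ.sup fun k => p k) hp
    omega
  have hn : ∀ i < n, singularSq S i ≠ 0 := by
    intro i hi h0
    rcases Nat.eq_zero_or_pos i with rfl | hi0
    · exact hS0 h0
    have hi1 : ⊥ < i := hi0
    obtain ⟨p, hp, hip⟩ := (Finset.le_sup_iff hi1).1 (Nat.lt_succ_iff.1 hi)
    obtain ⟨k, -, hk⟩ := (Finset.le_sup_iff hi1).1 hip
    have h1 : singularSq S (p k) = 0 :=
      le_antisymm (h0 ▸ singularSq_antitone hS hk) (singularSq_nonneg S _)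
    have h2 := (hJ p).1 hp
    rw [Finset.prod_eq_zero (Finset.mem_univ k) h1] at h2
    exact absurd h2 (not_lt.2 hτ.le)
  refine le_antisymm (Nat.sInf_le ?_) (le_csInf ⟨J.card, ?_⟩ ?_)
  -- The same algorithm bounds the infimum from above and shows that its set is nonempty.
  iterate 2
    exact exists_isLinearAlgorithm_scaledOp (s d) (tensorPowMap S d) J
      (fun p => hilbertTensor fun k => singularVector S (p k))
      (fun p => hilbertTensor fun k => S (singularVector S (p k))) hε.le
      (norm_tensorPowMap_sub_sq_le hS hn J hJn hτ.le fun p hp => not_lt.1 fun h => hp ((hJ p).2 h))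
  · rintro m ⟨A, hA, hw⟩
    exact card_le_of_worstCaseError_le hS (s d) J hε.le (fun p hp => (hJ p).1 hp) hA hw

theorem initialError_scaledTensorProblem {S : H →L[ℝ] G} (hS : IsCompactOperator S)
    (hS0 : singularSq S 0 ≠ 0) (s : ℕ → {x : ℝ // 0 < x}) (d : ℕ) :
    initialError (scaledTensorProblem S s d) = √((s d : ℝ) * singularSq S 0 ^ d) := by
  have hsd := (s d).2
  rw [initialError_eq_opNorm]
  refine le_antisymm (ContinuousLinearMap.opNorm_le_bound _ (Real.sqrt_nonneg _) fun x => ?_) ?_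
  · have h1 : ‖scaledTensorProblem S s d x‖ ≤ _ :=
      norm_tensorPowMap_apply_le S (ScaledSpace.toBase (s d) _ x)
    refine h1.trans ?_
    rw [singularSq_zero, ← pow_mul, mul_comm 2 d, pow_mul, Real.sqrt_mul hsd.le,
      Real.sqrt_sq (by positivity), mul_comm √_, mul_assoc]
    exact mul_le_mul_of_nonneg_left (norm_toBase_le _ _) (by positivity)
  · refine Real.sqrt_le_left (norm_nonneg _) |>.2 ?_
    -- The norm is attained at the tensor power of the top singular vector.
    let e : HilbertTensorPow H d := hilbertTensor fun _ => singularVector S 0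
    have h1 := (scaledTensorProblem S s d).le_opNorm e
    have h2 : ‖tensorPowMap S d e‖ ^ 2 ≤
        (‖scaledTensorProblem S s d‖ * ‖(show ScaledSpace (s d) (HilbertTensorPow H d) from e)‖) ^ 2 :=
      pow_le_pow_left₀ (norm_nonneg _) h1 2
    have h3 : ‖tensorPowMap S d e‖ ^ 2 = singularSq S 0 ^ d := by
      simp only [e]
      rw [tensorPowMap_hilbertTensor, norm_hilbertTensor_sq]
      simp [norm_apply_singularVector_sq hS]
    have h4 : ‖e‖ ^ 2 = 1 := by
      simp only [e]
      rw [norm_hilbertTensor_sq]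
      simp [norm_singularVector hS hS0]
    have h5 : ‖(show ScaledSpace (s d) (HilbertTensorPow H d) from e)‖ ^ 2 = (s d : ℝ)⁻¹ := by
      rw [scaledSpace_norm_sq]
      change (s d : ℝ)⁻¹ * ‖e‖ ^ 2 = _
      rw [h4, mul_one]
    rw [mul_pow, h3, h5, ← div_eq_mul_inv, le_div_iff₀ hsd] at h2
    linarith

end Complexity

/-! ### Counting multi-indices with a large product. -/

section Counting

/-- A nonincreasing null sequence `1 = μ 0 ≥ μ 1 ≥ ⋯ ≥ 0` with `μ 1 > 0`. -/
structure IsNormalizedSpectrum (μ : ℕ → ℝ) : Prop where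
  zero : μ 0 = 1
  one_pos : 0 < μ 1
  nonneg : ∀ n, 0 ≤ μ n
  antitone : Antitone μ
  tendsto : Tendsto μ atTop (𝓝 0)

variable {μ : ℕ → ℝ}

theorem IsNormalizedSpectrum.le_one (hμ : IsNormalizedSpectrum μ) (n : ℕ) : μ n ≤ 1 :=
  hμ.zero ▸ hμ.antitone (Nat.zero_le n)

theorem IsNormalizedSpectrum.finite (hμ : IsNormalizedSpectrum μ) (d : ℕ) {t : ℝ} (ht : 0 < t) :
    (largeIndices μ d t).Finite :=
  finite_largeIndices hμ.nonneg hμ.antitone hμ.tendsto d ht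

theorem largeIndices_normalize {ν : ℕ → ℝ} (h : 0 < ν 0) (d : ℕ) (τ : ℝ) :
    largeIndices ν d τ = largeIndices (fun n => ν n / ν 0) d (τ / ν 0 ^ d) := by
  ext p
  simp only [largeIndices, Set.mem_ofPred_eq, Finset.prod_div_distrib, Finset.prod_const,
    Finset.card_univ, Fintype.card_fin]
  exact (div_lt_div_iff_of_pos_right (pow_pos h d)).symm

theorem largeIndices_eq_empty (hμ : IsNormalizedSpectrum μ) (d : ℕ) {t : ℝ} (ht : 1 ≤ t) :
    largeIndices μ d t = ∅ := by
  refine Set.eq_empty_of_forall_notMem fun p hp => ?_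
  have h : ∏ k, μ (p k) ≤ 1 := Finset.prod_le_one (fun k _ => hμ.nonneg _) fun k _ => hμ.le_one _
  exact absurd (ht.trans_lt hp) (not_lt.2 h)

/-- Each subset of `k` fixed coordinates gives an index with entry `1` on it and `0` elsewhere,
whose product is at least `μ 1 ^ k`. -/
theorem two_pow_le_ncard (hμ : IsNormalizedSpectrum μ) {d k : ℕ} (hk : k ≤ d) {t : ℝ} (ht : 0 < t)
    (h : t < μ 1 ^ k) : 2 ^ k ≤ (largeIndices μ d t).ncard := by
  classical
  obtain ⟨T, -, hT⟩ := Finset.exists_subset_card_eq (s := (Finset.univ : Finset (Fin d)))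
    (n := k) (by simpa using hk)
  let f : Finset (Fin d) → Fin d → ℕ := fun A i => if i ∈ A then 1 else 0
  have hf : Function.Injective f := fun A B hAB => by
    ext i
    have := congrFun hAB i
    by_cases hA : i ∈ A <;> by_cases hB : i ∈ B <;> simp_all [f]
  have hsub : f '' (T.powerset : Set (Finset (Fin d))) ⊆ largeIndices μ d t := by
    rintro _ ⟨A, hA, rfl⟩
    have hA' : A ⊆ T := by simpa using hA
    have h1 : ∏ i, μ (f A i) = μ 1 ^ A.card := by
      simp only [f, apply_ite μ, hμ.zero]
      rw [Finset.prod_ite]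
      simp
    refine h.trans_le ?_
    rw [h1]
    exact pow_le_pow_of_le_one hμ.one_pos.le (hμ.le_one 1) (hT ▸ Finset.card_le_card hA')
  have h2 := Set.ncard_le_ncard hsub (hμ.finite d ht)
  rw [Set.ncard_image_of_injective _ hf, Set.ncard_coe_finset, Finset.card_powerset, hT] at h2
  exact h2

theorem succ_le_ncard (hμ : IsNormalizedSpectrum μ) {d m : ℕ} (hd : 1 ≤ d) {t : ℝ} (ht : 0 < t)
    (h : t < μ m) : m + 1 ≤ (largeIndices μ d t).ncard := by
  classical
  let k₀ : Fin d := ⟨0, hd⟩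
  let f : ℕ → Fin d → ℕ := fun i => Function.update 0 k₀ i
  have hf : Function.Injective f := Function.update_injective (0 : Fin d → ℕ) k₀
  have hsub : f '' (Finset.range (m + 1) : Set ℕ) ⊆ largeIndices μ d t := by
    rintro _ ⟨i, hi, rfl⟩
    have h1 : ∏ k, μ (f i k) = μ i := by
      rw [Finset.prod_eq_single k₀]
      · simp [f]
      · intro k _ hk
        simp [f, hk, hμ.zero]
      · simp
    have hi' : i ≤ m := by simpa [Nat.lt_succ_iff] using hi
    refine h.trans_le ?_
    rw [h1]
    exact hμ.antitone hi'
  have h2 := Set.ncard_le_ncard hsub (hμ.finite d ht)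
  rw [Set.ncard_image_of_injective _ hf, Set.ncard_coe_finset, Finset.card_range] at h2
  exact h2

theorem ncard_le_of_update {d A : ℕ} {X Y : Set (Fin d → ℕ)} (hY : Y.Finite)
    (h : ∀ p ∈ X, ∃ q ∈ Y, ∃ k, ∃ i < A, p = Function.update q k i) :
    X.Finite ∧ X.ncard ≤ Y.ncard * (d * A) := by
  let f : (Fin d → ℕ) × Fin d × ℕ → Fin d → ℕ := fun x => Function.update x.1 x.2.1 x.2.2
  have hfin : (Y ×ˢ (Set.univ : Set (Fin d)) ×ˢ (Finset.range A : Set ℕ)).Finite :=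
    hY.prod (Set.finite_univ.prod (Finset.finite_toSet _))
  have hsub : X ⊆ f '' (Y ×ˢ (Set.univ : Set (Fin d)) ×ˢ (Finset.range A : Set ℕ)) := by
    intro p hp
    obtain ⟨q, hq, k, i, hi, rfl⟩ := h p hp
    exact ⟨(q, k, i), ⟨hq, Set.mem_univ _, by simpa using hi⟩, rfl⟩
  refine ⟨(hfin.image f).subset hsub, (Set.ncard_le_ncard hsub (hfin.image f)).trans
    ((Set.ncard_image_le hfin).trans (le_of_eq ?_))⟩
  rw [Set.ncard_prod, Set.ncard_prod, Set.ncard_univ, Set.ncard_coe_finset, Finset.card_range,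
    Nat.card_eq_fintype_card, Fintype.card_fin]

/-- The multi-indices with entries below `A` and at most `m` entries that are not below `r`. -/
def boundedIndices (d r A m : ℕ) : Set (Fin d → ℕ) :=
  {p | (Finset.univ.filter fun k => r ≤ p k).card ≤ m ∧ ∀ k, p k < A}

theorem card_filter_update_zero_lt {d r : ℕ} (hr : 1 ≤ r) {p : Fin d → ℕ} {k : Fin d}
    (hk : r ≤ p k) :
    (Finset.univ.filter fun i => r ≤ Function.update p k 0 i).card
      < (Finset.univ.filter fun i => r ≤ p i).card := by
  refine Finset.card_lt_card (Finset.ssubset_iff_of_subset (fun i hi => ?_) |>.2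
    ⟨k, by simpa using hk, by simp; omega⟩)
  simp only [Finset.mem_filter, Finset.mem_univ, true_and] at hi ⊢
  rcases eq_or_ne i k with rfl | h
  · exact hk
  · rwa [Function.update_of_ne h] at hi

theorem boundedIndices_zero_subset (d r A : ℕ) :
    boundedIndices d r A 0 ⊆ (Fintype.piFinset fun _ : Fin d => Finset.range r :
      Finset (Fin d → ℕ)) := by
  intro p hp
  have h1 : (Finset.univ.filter fun k => r ≤ p k) = ∅ := by simpa using hp.1
  rw [Finset.mem_coe, Fintype.mem_piFinset]
  intro k
  rw [Finset.mem_range]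
  by_contra hk
  have : k ∈ (Finset.univ.filter fun k => r ≤ p k) := by simpa using hk
  rw [h1] at this
  simp at this

/-- Induction on `m`: resetting one entry `≥ r` to `0` lowers their number, and undoing this costs a
factor `d * A` for position and value. -/
theorem ncard_boundedIndices_le {d r A : ℕ} (hd : 1 ≤ d) (hr : 1 ≤ r) (m : ℕ) :
    (boundedIndices d r A m).Finite ∧ (boundedIndices d r A m).ncard ≤ r ^ d * (d * A) ^ m := by
  induction m with
  | zero =>
    refine ⟨(Finset.finite_toSet _).subset (boundedIndices_zero_subset d r A), ?_⟩
    refine (Set.ncard_le_ncard (boundedIndices_zero_subset d r A)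
      (Finset.finite_toSet _)).trans ?_
    rw [Set.ncard_coe_finset]
    simp
  | succ m ih =>
    have h := ncard_le_of_update (A := A) (X := boundedIndices d r A (m + 1)) ih.1 fun p hp => ?_
    · refine ⟨h.1, h.2.trans ?_⟩
      rw [pow_succ, ← mul_assoc (r ^ d)]
      exact Nat.mul_le_mul_right _ ih.2
    by_cases hex : ∃ k, r ≤ p k
    · obtain ⟨k, hk⟩ := hex
      refine ⟨Function.update p k 0, ⟨?_, fun i => ?_⟩, k, p k, hp.2 k, by simp⟩
      · have := card_filter_update_zero_lt hr hk
        have := hp.1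
        omega
      · rcases eq_or_ne i k with rfl | h
        · simpa using (Nat.zero_le _).trans_lt (hp.2 i)
        · simpa [Function.update_of_ne h] using hp.2 i
    · push Not at hex
      refine ⟨p, ⟨?_, hp.2⟩, ⟨0, hd⟩, p ⟨0, hd⟩, hp.2 _, by simp⟩
      rw [Finset.filter_false_of_mem fun k _ => not_le.2 (hex k)]
      simp

theorem prod_le_prod_subset (hμ : IsNormalizedSpectrum μ) {d : ℕ} (p : Fin d → ℕ)
    (T : Finset (Fin d)) : ∏ k, μ (p k) ≤ ∏ k ∈ T, μ (p k) :=
  Finset.prod_le_prod_of_subset_of_le_one (Finset.subset_univ T) (fun _ _ => hμ.nonneg _)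
    fun _ _ _ => hμ.le_one _

/-- All factors are at most `1`, so any subproduct `≤ t` excludes the index. This rules out `m + 1`
entries `≥ r`, two entries `≥ A`, and any entry `≥ B`. Resetting the possible single entry `≥ A`
leaves a bounded index. Allowing only one such entry is what keeps the large `B` out of the `m`-th
power. -/
theorem ncard_largeIndices_le (hμ : IsNormalizedSpectrum μ) {d r A B m : ℕ} (hd : 1 ≤ d)
    (hr : 1 ≤ r) (hA1 : 1 ≤ A) {t : ℝ} (hm : μ r ^ (m + 1) ≤ t) (hA : μ A ^ 2 ≤ t)
    (hB : μ B ≤ t) :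
    (largeIndices μ d t).ncard ≤ r ^ d * (d * A) ^ m * (d * B) := by
  have hX := ncard_boundedIndices_le (A := A) hd hr m
  refine (ncard_le_of_update (A := B) hX.1 fun p hp => ?_).2.trans (Nat.mul_le_mul_right _ hX.2)
  have hcard : (Finset.univ.filter fun k => r ≤ p k).card ≤ m := by
    by_contra! hcon
    refine absurd hp (not_lt.2 ((prod_le_prod_subset hμ p
      (Finset.univ.filter fun k => r ≤ p k)).trans (le_trans ?_ hm)))
    calc ∏ k ∈ Finset.univ.filter (fun k => r ≤ p k), μ (p k)
        ≤ ∏ _k ∈ Finset.univ.filter (fun k => r ≤ p k), μ r :=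
          Finset.prod_le_prod (fun k _ => hμ.nonneg _) fun k hk =>
            hμ.antitone (by simpa using hk)
      _ ≤ μ r ^ (m + 1) := by
          rw [Finset.prod_const]
          exact pow_le_pow_of_le_one (hμ.nonneg r) (hμ.le_one r) hcon
  have hpB : ∀ k, p k < B := fun k => by
    by_contra! hcon
    refine absurd hp (not_lt.2 ((prod_le_prod_subset hμ p {k}).trans (le_trans ?_ hB)))
    simpa using hμ.antitone hcon
  have huniq : ∀ k k', A ≤ p k → A ≤ p k' → k = k' := fun k k' hk hk' => by
    by_contra hne
    refine absurd hp (not_lt.2 ((prod_le_prod_subset hμ p {k, k'}).trans (le_trans ?_ hA)))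
    rw [Finset.prod_pair hne, sq]
    exact mul_le_mul (hμ.antitone hk) (hμ.antitone hk') (hμ.nonneg _) (hμ.nonneg _)
  by_cases hex : ∃ k, A ≤ p k
  · obtain ⟨k, hk⟩ := hex
    refine ⟨Function.update p k 0, ⟨?_, fun i => ?_⟩, k, p k, hpB k, by simp⟩
    · refine (Finset.card_le_card fun i hi => ?_).trans hcard
      simp only [Finset.mem_filter, Finset.mem_univ, true_and] at hi ⊢
      rcases eq_or_ne i k with rfl | h
      · simp at hi
        omega
      · rwa [Function.update_of_ne h] at hi
    · rcases eq_or_ne i k with rfl | h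
      · rw [Function.update_self]
        exact hA1
      · rw [Function.update_of_ne h]
        by_contra! hcon
        exact h (huniq i k hcon hk)
  · push Not at hex
    exact ⟨p, ⟨hcard, hex⟩, ⟨0, hd⟩, p ⟨0, hd⟩, hpB _, by simp⟩

end Counting

/-! ### Asymptotic upper bounds for the count. -/

section Asymptotics

/-- Weak tractability in `ε`-`δ` form. -/
theorem weaklyTractable_iff {F G : ℕ → Type*} [∀ d, NormedAddCommGroup (F d)]
    [∀ d, NormedSpace ℝ (F d)] [∀ d, NormedAddCommGroup (G d)] [∀ d, NormedSpace ℝ (G d)]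
    (P : ∀ d, F d →L[ℝ] G d) :
    WeaklyTractable P ↔ ∀ η : ℝ, 0 < η → ∃ Y : ℝ, ∀ (ε : ℝ) (d : ℕ), 0 < ε → ε ≤ 1 → 1 ≤ d →
      ε < initialError (P d) → Y ≤ ε⁻¹ + d →
      Real.log (infoComplexity (P d) ε) ≤ η * (ε⁻¹ + d) := by
  constructor
  · intro h η hη
    by_contra! hcon
    choose ε d h0 h1 hd hI hY hlog using fun k : ℕ => hcon k
    have hlim : Tendsto (fun k => (ε k)⁻¹ + (d k : ℝ)) atTop atTop :=
      tendsto_atTop_mono hY tendsto_natCast_atTop_atTop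
    have h2 := h ε d (fun k => ⟨h0 k, h1 k, hd k, hI k⟩) hlim
    obtain ⟨k, hk⟩ := ((tendsto_order.1 h2).2 η hη).exists
    have hpos : 0 < (ε k)⁻¹ + (d k : ℝ) := by
      have := inv_pos.2 (h0 k)
      positivity
    rw [div_lt_iff₀ hpos] at hk
    exact lt_asymm hk (hlog k)
  · intro h ε d hεd hlim
    have hpos : ∀ k, 0 < (ε k)⁻¹ + (d k : ℝ) := fun k => by
      have := inv_pos.2 (hεd k).1
      positivity
    refine tendsto_order.2 ⟨fun a ha => Eventually.of_forall fun k =>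
      ha.trans_le (div_nonneg (Real.log_natCast_nonneg _) (hpos k).le), fun a ha => ?_⟩
    obtain ⟨Y, hY⟩ := h (a / 2) (half_pos ha)
    filter_upwards [hlim.eventually_ge_atTop Y] with k hk
    obtain ⟨h0, h1, hd, hI⟩ := hεd k
    rw [div_lt_iff₀ (hpos k)]
    have := mul_lt_mul_of_pos_right (half_lt_self ha) (hpos k)
    exact (hY _ _ h0 h1 hd hI hk).trans_lt this

variable {μ : ℕ → ℝ}

/-- The decay condition in inverse form: `B` is about `exp (η t^(-1/β))`, and `K` absorbs the
rounding and the finitely many initial indices. -/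
theorem exists_index_log_le {β : ℝ} (hβ : 0 < β)
    (h : μ =o[atTop] fun n : ℕ => Real.log ((n + 1 : ℕ) : ℝ) ^ (-β)) {η : ℝ} (hη : 0 < η) :
    ∃ K : ℝ, 0 ≤ K ∧ ∀ t : ℝ, 0 < t → ∃ B : ℕ, 1 ≤ B ∧ μ B ≤ t ∧
      Real.log B ≤ η * t⁻¹ ^ β⁻¹ + K := by
  -- The constant `η ^ β` cancels against `y ^ (-β)` for `y = η t^(-1/β)`, which leaves exactly `t`.
  obtain ⟨N, hN⟩ := eventually_atTop.1 (isLittleO_iff.1 h (Real.rpow_pos_of_pos hη β))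
  refine ⟨Real.log ((N : ℝ) + 2), Real.log_nonneg (by
    have : (0 : ℝ) ≤ N := N.cast_nonneg
    linarith), fun t ht => ?_⟩
  set y : ℝ := η * t⁻¹ ^ β⁻¹ with hy
  have ht' : 0 < t⁻¹ := inv_pos.2 ht
  have hy0 : 0 < y := mul_pos hη (Real.rpow_pos_of_pos ht' _)
  have hexp : 1 ≤ Real.exp y := Real.one_le_exp hy0.le
  set B : ℕ := max N ⌈Real.exp y⌉₊ with hB
  have hB1 : 1 ≤ ⌈Real.exp y⌉₊ := Nat.one_le_ceil_iff.2 (Real.exp_pos y)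
  have hBexp : Real.exp y ≤ B := (Nat.le_ceil _).trans (by exact_mod_cast le_max_right _ _)
  have hBpos : (0 : ℝ) < B := (Real.exp_pos y).trans_le hBexp
  refine ⟨B, hB1.trans (le_max_right _ _), ?_, ?_⟩
  · have h1 := hN B (le_max_left _ _)
    have hlog : y ≤ Real.log ((B + 1 : ℕ) : ℝ) := by
      rw [Real.le_log_iff_exp_le (by positivity)]
      push_cast
      linarith
    have h2 : Real.log ((B + 1 : ℕ) : ℝ) ^ (-β) ≤ y ^ (-β) :=
      Real.rpow_le_rpow_of_nonpos hy0 hlog (by linarith)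
    have h3 : y ^ (-β) = (η ^ β)⁻¹ * t := by
      rw [Real.rpow_neg hy0.le, hy, Real.mul_rpow hη.le (Real.rpow_nonneg ht'.le _),
        ← Real.rpow_mul ht'.le, inv_mul_cancel₀ hβ.ne', Real.rpow_one, mul_inv, inv_inv]
    have hηβ := Real.rpow_pos_of_pos hη β
    calc μ B ≤ ‖μ B‖ := Real.le_norm_self _
      _ ≤ η ^ β * ‖Real.log ((B + 1 : ℕ) : ℝ) ^ (-β)‖ := h1
      _ = η ^ β * Real.log ((B + 1 : ℕ) : ℝ) ^ (-β) := by
        rw [Real.norm_of_nonneg (Real.rpow_nonneg (hy0.le.trans hlog) _)]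
      _ ≤ η ^ β * ((η ^ β)⁻¹ * t) := by rw [← h3]; gcongr
      _ = t := by rw [mul_inv_cancel_left₀ hηβ.ne']
  · have hBle : (B : ℝ) ≤ (N + 2) * Real.exp y := by
      have h1 : (⌈Real.exp y⌉₊ : ℝ) < Real.exp y + 1 := Nat.ceil_lt_add_one (Real.exp_pos y).le
      have h2 : (B : ℝ) ≤ N + ⌈Real.exp y⌉₊ := by exact_mod_cast max_le_add_of_nonneg (by simp) (by simp)
      have h3 : (0 : ℝ) ≤ N := N.cast_nonneg
      nlinarith
    calc Real.log B ≤ Real.log ((N + 2) * Real.exp y) := Real.log_le_log hBpos hBle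
      _ = y + Real.log (N + 2) := by
        rw [Real.log_mul (by positivity) (Real.exp_pos y).ne', Real.log_exp, add_comm]

theorem exists_floor_pow_le {ρ : ℝ} (h0 : 0 < ρ) (h1 : ρ < 1) {t : ℝ} (ht : 0 < t) (ht1 : t ≤ 1) :
    ∃ m : ℕ, ρ ^ (m + 1) ≤ t ∧ (m : ℝ) ≤ Real.log t⁻¹ / Real.log ρ⁻¹ := by
  have hL : 0 < Real.log ρ⁻¹ := Real.log_pos (one_lt_inv_iff₀.2 ⟨h0, h1⟩)
  have ht' : 0 ≤ Real.log t⁻¹ := Real.log_nonneg (one_le_inv_iff₀.2 ⟨ht, ht1⟩)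
  refine ⟨⌊Real.log t⁻¹ / Real.log ρ⁻¹⌋₊, ?_, Nat.floor_le (by positivity)⟩
  have h2 := Nat.lt_floor_add_one (Real.log t⁻¹ / Real.log ρ⁻¹)
  rw [div_lt_iff₀ hL, Real.log_inv, Real.log_inv] at h2
  rw [← Real.log_le_log_iff (by positivity) ht, Real.log_pow]
  push_cast
  rw [Real.log_inv, Real.log_inv]
  linarith

theorem log_le_log_natCast {a b : ℕ} (h : a ≤ b) : Real.log a ≤ Real.log b := by
  rcases Nat.eq_zero_or_pos a with rfl | ha
  · simpa using Real.log_natCast_nonneg b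
  · exact Real.log_le_log (by exact_mod_cast ha) (by exact_mod_cast h)

theorem log_ncard_largeIndices_le (hμ : IsNormalizedSpectrum μ) {d r A B m : ℕ} (hd : 1 ≤ d)
    (hr : 1 ≤ r) (hA1 : 1 ≤ A) (hB1 : 1 ≤ B) {t : ℝ} (hm : μ r ^ (m + 1) ≤ t)
    (hA : μ A ^ 2 ≤ t) (hB : μ B ≤ t) :
    Real.log ((largeIndices μ d t).ncard) ≤ d * Real.log r +
      m * (Real.log d + Real.log A) + (Real.log d + Real.log B) := by
  refine (log_le_log_natCast (ncard_largeIndices_le hμ hd hr hA1 hm hA hB)).trans (le_of_eq ?_)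
  have h1 : (d : ℝ) ≠ 0 := by positivity
  have h2 : (r : ℝ) ≠ 0 := by positivity
  have h3 : (A : ℝ) ≠ 0 := by positivity
  have h4 : (B : ℝ) ≠ 0 := by positivity
  push_cast
  rw [Real.log_mul (by positivity) (by positivity), Real.log_mul (by positivity) (by positivity),
    Real.log_pow, Real.log_pow, Real.log_mul h1 h3, Real.log_mul h1 h4]

/-- The upper bound for the information complexity of a problem with polynomially bounded
initial errors. -/
theorem log_ncard_le_of_isLittleO (hμ : IsNormalizedSpectrum μ) {α : ℝ} (hα : 0 ≤ α)
    (hdec : μ =o[atTop] fun n : ℕ => Real.log ((n + 1 : ℕ) : ℝ) ^ (-(2 * (1 + α))))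
    {I : ℕ → ℝ} (hI0 : ∀ d, 1 ≤ d → 0 < I d) {C : ℝ} (hC : 1 ≤ C)
    (hI : ∀ d : ℕ, 1 ≤ d → I d ≤ C * (d : ℝ) ^ α) {r : ℕ} (hr : 1 ≤ r) (hr1 : μ r < 1)
    {η : ℝ} (hη : 0 < η) :
    ∃ Y : ℝ, ∀ (ε : ℝ) (d : ℕ), 0 < ε → 1 ≤ d → ε < I d → Y ≤ ε⁻¹ + d →
      Real.log ((largeIndices μ d ((ε / I d) ^ 2)).ncard)
        ≤ d * Real.log r + η * (ε⁻¹ + d) := by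
  set β : ℝ := 2 * (1 + α) with hβdef
  have hβ : 0 < β := by positivity
  obtain ⟨K₁, hK₁, hA⟩ := exists_index_log_le hβ hdec one_pos
  -- `A` will be taken at level `u = ε / I d`, where any constant is good enough, and `B` at level
  -- `u ^ 2`, where this constant leaves `η / 2 * Y`.
  obtain ⟨K₂, hK₂, hB⟩ := exists_index_log_le hβ hdec (η := η / (2 * C ^ 2)) (by positivity)
  -- The maximum keeps `log ρ⁻¹` meaningful if `μ r = 0`.
  set ρ : ℝ := max (μ r) (1 / 2) with hρ
  have hρ0 : 0 < ρ := lt_max_of_lt_right (by norm_num)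
  have hρ1 : ρ < 1 := max_lt hr1 (by norm_num)
  have hL : 0 < Real.log ρ⁻¹ := Real.log_pos (one_lt_inv_iff₀.2 ⟨hρ0, hρ1⟩)
  have hlogC : 0 ≤ Real.log C := Real.log_nonneg hC
  set M₁ : ℝ := (2 * Real.log C + 4 * β) / Real.log ρ⁻¹ with hM₁
  have hM₁0 : 0 ≤ M₁ := by positivity
  set M : ℝ := M₁ * (2 + C + K₁) + 2 + K₂ with hM
  have hM0 : 0 ≤ M := by positivity
  refine ⟨(2 * M / η) ^ 4, fun ε d hε hd hεI hY => ?_⟩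
  have hId := hI0 d hd
  set Y : ℝ := ε⁻¹ + d with hYdef
  have hεinv : 0 < ε⁻¹ := inv_pos.2 hε
  have hd1 : (1 : ℝ) ≤ d := by exact_mod_cast hd
  have hdY : (d : ℝ) ≤ Y := by linarith
  have hεY : ε⁻¹ ≤ Y := by linarith
  have hY1 : 1 ≤ Y := by linarith
  have hY0 : 0 ≤ Y := by linarith
  -- In powers of `q`: `m` is `O(q)` because logarithms are, and `log A` is `O(q²)`. So all terms
  -- except `d log r` and the main part of `log B` are at most `M q³`, against `Y = q⁴`.
  set q : ℝ := Y ^ (1 / 4 : ℝ) with hq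
  have hq1 : 1 ≤ q := Real.one_le_rpow hY1 (by norm_num)
  have hqY : q ^ 4 = Y := by
    rw [hq, ← Real.rpow_natCast, ← Real.rpow_mul hY0]
    norm_num
  have hqY2 : q ^ 2 = Y ^ (1 / 2 : ℝ) := by
    rw [hq, ← Real.rpow_natCast, ← Real.rpow_mul hY0]
    norm_num
  have hqM : M ≤ η / 2 * q := by
    have h1 : 2 * M / η ≤ q := le_of_pow_le_pow_left₀ four_ne_zero (by positivity) (hqY ▸ hY)
    rw [div_le_iff₀ hη] at h1
    linarith
  have hlogY : Real.log Y ≤ 4 * q := by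
    have := Real.log_le_rpow_div hY0 (ε := 1 / 4) (by norm_num)
    linarith
  have hlogY2 : Real.log Y ≤ 2 * q ^ 2 := by
    have := Real.log_le_rpow_div hY0 (ε := 1 / 2) (by norm_num)
    rw [hqY2]
    linarith
  set u : ℝ := ε / I d with hu
  have hu0 : 0 < u := by positivity
  have hu1 : u ≤ 1 := (div_le_one hId).2 hεI.le
  have huinv : u⁻¹ ≤ C * Y ^ (1 + α) := by
    rw [hu, inv_div, div_eq_mul_inv, add_comm 1 α, Real.rpow_add_one (by linarith), ← mul_assoc]
    refine mul_le_mul ((hI d hd).trans ?_) hεY hεinv.le (by positivity)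
    gcongr
  have huinv0 : 0 ≤ u⁻¹ := by positivity
  -- The exponent `β = 2(1 + α)` turns the bound `C * Y ^ (1 + α)` for `u⁻¹` into a multiple of
  -- `√Y`; `C ^ β⁻¹ ≤ C` since `β, C ≥ 1`.
  have hsqrt : u⁻¹ ^ β⁻¹ ≤ C * q ^ 2 := by
    have h1 : u⁻¹ ^ β⁻¹ ≤ (C * Y ^ (1 + α)) ^ β⁻¹ := by gcongr
    refine h1.trans ?_
    rw [Real.mul_rpow (by linarith) (by positivity), ← Real.rpow_mul hY0, hqY2]
    have h2 : (1 + α) * β⁻¹ = 1 / 2 := by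
      rw [hβdef]
      field_simp
    rw [h2]
    gcongr
    calc C ^ β⁻¹ ≤ C ^ (1 : ℝ) := Real.rpow_le_rpow_of_exponent_le hC (inv_le_one_of_one_le₀ (by linarith))
      _ = C := Real.rpow_one C
  have hsq : (u ^ 2)⁻¹ ^ β⁻¹ ≤ C ^ 2 * Y := by
    have h1 : (u ^ 2)⁻¹ ^ β⁻¹ = (u⁻¹ ^ β⁻¹) ^ 2 := by
      rw [← inv_pow, ← Real.rpow_natCast, ← Real.rpow_natCast, ← Real.rpow_mul huinv0,
        ← Real.rpow_mul huinv0, mul_comm]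
    rw [h1, ← hqY]
    calc (u⁻¹ ^ β⁻¹) ^ 2 ≤ (C * q ^ 2) ^ 2 := by gcongr
      _ = C ^ 2 * q ^ 4 := by ring
  obtain ⟨A, hA1, hAμ, hAlog⟩ := hA u hu0
  obtain ⟨B, hB1, hBμ, hBlog⟩ := hB (u ^ 2) (by positivity)
  obtain ⟨m, hm, hmle⟩ := exists_floor_pow_le hρ0 hρ1 (t := u ^ 2) (by positivity)
    (pow_le_one₀ hu0.le hu1)
  have hm' : μ r ^ (m + 1) ≤ u ^ 2 :=
    (pow_le_pow_left₀ (hμ.nonneg r) (le_max_left _ _) _).trans hm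
  refine (log_ncard_largeIndices_le hμ hd hr hA1 hB1 hm'
    (pow_le_pow_left₀ (hμ.nonneg A) hAμ 2) hBμ).trans ?_
  have hmM : (m : ℝ) ≤ M₁ * q := by
    refine hmle.trans ?_
    rw [hM₁, div_mul_eq_mul_div]
    refine div_le_div_of_nonneg_right ?_ hL.le
    have h1 : Real.log u⁻¹ ≤ Real.log C + (1 + α) * Real.log Y := by
      have h2 := Real.log_le_log (by positivity) huinv
      rwa [Real.log_mul (by positivity) (by positivity), Real.log_rpow (by linarith)] at h2
    have h3 : Real.log (u ^ 2)⁻¹ = 2 * Real.log u⁻¹ := by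
      rw [← inv_pow, Real.log_pow]
      norm_num
    rw [h3]
    have h4 : (1 + α) * Real.log Y ≤ (1 + α) * (4 * q) := by gcongr
    have h5 : Real.log C ≤ Real.log C * q := le_mul_of_one_le_right hlogC hq1
    rw [hβdef]
    linarith
  have hlogd : Real.log d ≤ Real.log Y := Real.log_le_log (by linarith) hdY
  have hq2 : 1 ≤ q ^ 2 := one_le_pow₀ hq1
  have hq3 : q ^ 2 ≤ q ^ 3 := pow_le_pow_right₀ hq1 (by norm_num)
  have hfac : Real.log d + Real.log A ≤ (2 + C + K₁) * q ^ 2 := by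
    have : K₁ ≤ K₁ * q ^ 2 := le_mul_of_one_le_right hK₁ hq2
    linarith
  have hlast : Real.log d + Real.log B ≤ (2 + K₂) * q ^ 3 + η / 2 * Y := by
    have h1 : K₂ ≤ K₂ * q ^ 3 := le_mul_of_one_le_right hK₂ (hq2.trans hq3)
    have h2 : η / (2 * C ^ 2) * (u ^ 2)⁻¹ ^ β⁻¹ ≤ η / (2 * C ^ 2) * (C ^ 2 * Y) := by gcongr
    have h3 : η / (2 * C ^ 2) * (C ^ 2 * Y) = η / 2 * Y := by field_simp
    linarith
  have hprod : m * (Real.log d + Real.log A) ≤ M₁ * (2 + C + K₁) * q ^ 3 := by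
    calc (m : ℝ) * (Real.log d + Real.log A) ≤ M₁ * q * ((2 + C + K₁) * q ^ 2) :=
          mul_le_mul hmM hfac (add_nonneg (Real.log_natCast_nonneg d) (Real.log_natCast_nonneg A))
            (by positivity)
      _ = M₁ * (2 + C + K₁) * q ^ 3 := by ring
  have hfin : M * q ^ 3 ≤ η / 2 * Y := by
    calc M * q ^ 3 ≤ η / 2 * q * q ^ 3 := by gcongr
      _ = η / 2 * Y := by rw [← hqY]; ring
  rw [hM] at hfin
  linarith

end Asymptotics

/-! ### From counting bounds to tractability and the curse. -/

section Tractability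

variable {μ : ℕ → ℝ}

/-- Apply `hchoice` to `x = μ n`: the threshold lies below `μ n`, so at least `n + 1` indices count,
while `ε⁻¹ + d` is comparable to `(μ n)^(-1/β)`. The assumed bound on the logarithm then becomes the
decay of `μ`. -/
theorem isLittleO_of_log_ncard_le (hμ : IsNormalizedSpectrum μ) {β M δ : ℝ} (hβ : 0 < β)
    (hM : 0 < M) (hδ : 0 < δ) {I : ℕ → ℝ} (hI0 : ∀ d, 0 < I d)
    (hchoice : ∀ x : ℝ, 0 < x → x ≤ δ → ∃ (ε : ℝ) (d : ℕ), 0 < ε ∧ ε ≤ 1 ∧ 1 ≤ d ∧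
      ε < I d * √x ∧ x⁻¹ ^ β⁻¹ ≤ ε⁻¹ + d ∧ ε⁻¹ + d ≤ M * x⁻¹ ^ β⁻¹)
    (hb : ∀ η : ℝ, 0 < η → ∃ Y : ℝ, ∀ (ε : ℝ) (d : ℕ), 0 < ε → ε ≤ 1 → 1 ≤ d → ε < I d →
      Y ≤ ε⁻¹ + d → Real.log ((largeIndices μ d ((ε / I d) ^ 2)).ncard) ≤ η * (ε⁻¹ + d)) :
    μ =o[atTop] fun n : ℕ => Real.log ((n + 1 : ℕ) : ℝ) ^ (-β) := by
  refine isLittleO_iff.2 fun c hc => ?_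
  obtain ⟨Y, hY⟩ := hb (c ^ β⁻¹ / M) (div_pos (Real.rpow_pos_of_pos hc _) hM)
  set Z : ℝ := max Y 1 with hZ
  have hZ0 : 0 < Z := lt_max_of_lt_right one_pos
  have hsmall : ∀ᶠ n in atTop, μ n < min δ (Z⁻¹ ^ β) :=
    (tendsto_order.1 hμ.tendsto).2 _ (lt_min hδ (by positivity))
  filter_upwards [hsmall, eventually_ge_atTop 1] with n hn hn1
  have hlog : 0 < Real.log ((n + 1 : ℕ) : ℝ) := Real.log_pos (by exact_mod_cast Nat.lt_succ_of_le hn1)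
  rw [Real.norm_of_nonneg (hμ.nonneg n), Real.norm_of_nonneg (by positivity)]
  rcases (hμ.nonneg n).eq_or_lt with h0 | hpos
  · rw [← h0]
    positivity
  obtain ⟨ε, d, hε, hε1, hd, hεI, hle, hge⟩ := hchoice (μ n) hpos (hn.trans_le (min_le_left _ _)).le
  have hsq1 : √(μ n) ≤ 1 := Real.sqrt_le_one.2 (hμ.le_one n)
  have hYle : Y ≤ ε⁻¹ + d := by
    refine (le_max_left Y 1).trans (le_trans ?_ hle)
    have h1 : μ n ≤ Z⁻¹ ^ β := (hn.trans_le (min_le_right _ _)).le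
    have h2 : Z ^ β ≤ (μ n)⁻¹ := by
      rw [Real.inv_rpow hZ0.le] at h1
      exact (le_inv_comm₀ hpos (by positivity)).1 h1
    exact (Real.le_rpow_inv_iff_of_pos hZ0.le (by positivity) hβ).2 h2
  have hcount : n + 1 ≤ (largeIndices μ d ((ε / I d) ^ 2)).ncard := by
    refine succ_le_ncard hμ hd (pow_pos (div_pos hε (hI0 d)) 2) ?_
    rw [← Real.lt_sqrt (div_pos hε (hI0 d)).le, div_lt_iff₀ (hI0 d), mul_comm]
    exact hεI
  have hfin := (log_le_log_natCast hcount).trans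
    (hY ε d hε hε1 hd (hεI.trans_le (mul_le_of_le_one_right (hI0 d).le hsq1)) hYle)
  have h3 : Real.log ((n + 1 : ℕ) : ℝ) ≤ (c * (μ n)⁻¹) ^ β⁻¹ := by
    refine hfin.trans ?_
    rw [Real.mul_rpow hc.le (by positivity)]
    calc c ^ β⁻¹ / M * (ε⁻¹ + d) ≤ c ^ β⁻¹ / M * (M * (μ n)⁻¹ ^ β⁻¹) := by gcongr
      _ = c ^ β⁻¹ * (μ n)⁻¹ ^ β⁻¹ := by field_simp
  have h4 := (Real.le_rpow_inv_iff_of_pos hlog.le (by positivity) hβ).1 h3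
  rw [Real.rpow_neg hlog.le, ← div_eq_mul_inv, le_div_iff₀ (by positivity)]
  rw [← div_eq_mul_inv, le_div_iff₀ hpos] at h4
  linarith

/-- With `y = x^(-1/(2(1+α)))`, take `d = ⌈y⌉` and `ε = c / (2d)`. Then `√x ≥ d^(-(1+α))`, so `I d *
√x ≥ c / d > ε`, and both `d` and `ε⁻¹` have order `y`. -/
theorem exists_choice_of_polynomial {α : ℝ} (hα : 0 ≤ α) {I : ℕ → ℝ} {c : ℝ} (hc : 0 < c)
    (hc1 : c ≤ 1) {D : ℕ} (hI : ∀ d : ℕ, D ≤ d → c * (d : ℝ) ^ α ≤ I d) :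
    ∃ M δ : ℝ, 0 < M ∧ 0 < δ ∧ ∀ x : ℝ, 0 < x → x ≤ δ → ∃ (ε : ℝ) (d : ℕ), 0 < ε ∧ ε ≤ 1 ∧ 1 ≤ d ∧
      ε < I d * √x ∧ x⁻¹ ^ (2 * (1 + α))⁻¹ ≤ ε⁻¹ + d ∧
      ε⁻¹ + d ≤ M * x⁻¹ ^ (2 * (1 + α))⁻¹ := by
  have hβ : 0 < 2 * (1 + α) := by positivity
  refine ⟨2 * (2 / c + 1), ((D : ℝ) + 1)⁻¹ ^ (2 * (1 + α)), by positivity, by positivity,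
    fun x hx hxδ => ?_⟩
  set y : ℝ := x⁻¹ ^ (2 * (1 + α))⁻¹ with hy
  have hx' : 0 < x⁻¹ := inv_pos.2 hx
  have hDy : (D : ℝ) + 1 ≤ y := by
    refine (Real.le_rpow_inv_iff_of_pos (by positivity) hx'.le hβ).2 ?_
    rw [Real.inv_rpow (by positivity)] at hxδ
    exact (le_inv_comm₀ hx (by positivity)).1 hxδ
  have hD0 : (0 : ℝ) ≤ D := D.cast_nonneg
  have hy1 : 1 ≤ y := by linarith
  set d : ℕ := ⌈y⌉₊ with hd
  have hyd : y ≤ d := Nat.le_ceil y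
  have hd2 : (d : ℝ) ≤ 2 * y := by
    have := Nat.ceil_lt_add_one (zero_le_one.trans hy1)
    linarith
  have hd1 : (1 : ℝ) ≤ d := hy1.trans hyd
  have hdpos : (0 : ℝ) < d := by linarith
  have hDd : D ≤ d := by
    have : (D : ℝ) ≤ d := by linarith
    exact_mod_cast this
  have hsum : (c / (2 * d))⁻¹ + d = (2 / c + 1) * d := by
    field_simp
  refine ⟨c / (2 * d), d, by positivity, ?_, by exact_mod_cast hd1, ?_, ?_, ?_⟩
  · rw [div_le_one (by positivity)]
    linarith
  · have h1 : (√x)⁻¹ ≤ (d : ℝ) ^ α * d := by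
      calc (√x)⁻¹ = y ^ (1 + α) := by
            rw [hy, ← Real.rpow_mul hx'.le, ← Real.sqrt_inv, Real.sqrt_eq_rpow]
            congr 1
            field_simp
        _ ≤ (d : ℝ) ^ (1 + α) := by gcongr
        _ = (d : ℝ) ^ α * d := by rw [add_comm, Real.rpow_add_one hdpos.ne']
    have hsx : 0 < √x := Real.sqrt_pos.2 hx
    rw [inv_le_iff_one_le_mul₀ hsx] at h1
    have h2 : c ≤ d * (I d * √x) := by
      calc c ≤ c * ((d : ℝ) ^ α * d * √x) := le_mul_of_one_le_right hc.le h1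
        _ = d * (c * (d : ℝ) ^ α * √x) := by ring
        _ ≤ d * (I d * √x) := by
          have := hI d hDd
          gcongr
    rw [div_lt_iff₀ (by positivity)]
    linarith
  · rw [hsum]
    have : (1 : ℝ) * d ≤ (2 / c + 1) * d :=
      mul_le_mul_of_nonneg_right (le_add_of_nonneg_left (by positivity)) hdpos.le
    linarith
  · rw [hsum]
    calc (2 / c + 1) * d ≤ (2 / c + 1) * (2 * y) := by gcongr
      _ = 2 * (2 / c + 1) * y := by ring

/-- Dimension one suffices, with `ε` a small multiple of `√x`; no lower bound on the other initial
errors is needed. -/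
theorem exists_choice_of_pos {I : ℕ → ℝ} (hI : 0 < I 1) :
    ∃ M δ : ℝ, 0 < M ∧ 0 < δ ∧ ∀ x : ℝ, 0 < x → x ≤ δ → ∃ (ε : ℝ) (d : ℕ), 0 < ε ∧ ε ≤ 1 ∧ 1 ≤ d ∧
      ε < I d * √x ∧ x⁻¹ ^ (2 : ℝ)⁻¹ ≤ ε⁻¹ + d ∧ ε⁻¹ + d ≤ M * x⁻¹ ^ (2 : ℝ)⁻¹ := by
  set c : ℝ := min (I 1) 1 with hc
  have hc0 : 0 < c := lt_min hI one_pos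
  refine ⟨2 / c + 1, 1, by positivity, one_pos, fun x hx hx1 => ?_⟩
  have hsx : 0 < √x := Real.sqrt_pos.2 hx
  have hsx1 : √x ≤ 1 := Real.sqrt_le_one.2 hx1
  have hinv : 1 ≤ (√x)⁻¹ := one_le_inv_iff₀.2 ⟨hsx, hsx1⟩
  have hpow : x⁻¹ ^ (2 : ℝ)⁻¹ = (√x)⁻¹ := by
    rw [← Real.sqrt_inv, Real.sqrt_eq_rpow, one_div]
  have hcx : c * √x ≤ 1 := mul_le_one₀ (min_le_right _ _) hsx.le hsx1
  have hεinv : (c * √x / 2)⁻¹ = 2 / c * (√x)⁻¹ := by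
    field_simp
  have h2c : 1 ≤ 2 / c := by
    rw [one_le_div hc0]
    have : c ≤ 1 := min_le_right _ _
    linarith
  rw [hpow]
  refine ⟨c * √x / 2, 1, by positivity, by linarith, le_rfl, ?_, ?_, ?_⟩
  · have : c * √x ≤ I 1 * √x := by gcongr; exact min_le_left _ _
    have : 0 < c * √x := by positivity
    linarith
  · rw [hεinv]
    have := le_mul_of_one_le_left (zero_le_one.trans hinv) h2c
    push_cast
    linarith
  · rw [hεinv]
    push_cast
    linarith

variable {F G : ℕ → Type*} [∀ d, NormedAddCommGroup (F d)] [∀ d, NormedSpace ℝ (F d)]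
  [∀ d, NormedAddCommGroup (G d)] [∀ d, NormedSpace ℝ (G d)]

/-- The information complexities of a sequence of problems are determined by its initial errors
and by the normalized spectrum `μ` of a tensor product problem. -/
structure HasTensorSpectrum (P : ∀ d, F d →L[ℝ] G d) (μ : ℕ → ℝ) : Prop where
  spectrum : IsNormalizedSpectrum μ
  initialError_pos : ∀ d, 0 < initialError (P d)
  infoComplexity_eq : ∀ (d : ℕ) (ε : ℝ), 0 < ε →
    infoComplexity (P d) ε = (largeIndices μ d ((ε / initialError (P d)) ^ 2)).ncard

variable {P : ∀ d, F d →L[ℝ] G d}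

theorem HasTensorSpectrum.curse_of_exponential (hP : HasTensorSpectrum P μ) {δ : ℝ} (hδ : 0 < δ)
    (h : ∃ᶠ d : ℕ in atTop, δ * d < Real.log (initialError (P d))) : CurseOfDimensionality P := by
  have hμ1 := hP.spectrum.one_pos
  set ℓ : ℝ := Real.log (μ 1)⁻¹ with hℓ
  have hℓ0 : 0 ≤ ℓ := Real.log_nonneg (one_le_inv_iff₀.2 ⟨hμ1, hP.spectrum.le_one 1⟩)
  -- For `k = ⌊c d⌋`, the bound `c ≤ 1` gives `k ≤ d`, and `c ℓ ≤ 2δ` keeps `μ 1 ^ k` above the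
  -- threshold for `ε = 1`. The `+ 1` covers `ℓ = 0`.
  set c : ℝ := min 1 (2 * δ / (ℓ + 1)) with hc
  have hc0 : 0 < c := lt_min one_pos (by positivity)
  have hcℓ : c * ℓ ≤ 2 * δ := by
    have h1 : c * (ℓ + 1) ≤ 2 * δ := (le_div_iff₀ (by positivity)).1 (min_le_right _ _)
    linarith
  -- The growth rate is `2 ^ c`; the factor `1 / 2` pays for the floor.
  refine ⟨1, one_pos, 1 / 2, by norm_num, (2 : ℝ) ^ c - 1,
    sub_pos.2 (Real.one_lt_rpow one_lt_two hc0), h.mono fun d hd => ?_⟩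
  have hI := hP.initialError_pos d
  rw [hP.infoComplexity_eq d 1 one_pos]
  have hd0 : (0 : ℝ) ≤ d := d.cast_nonneg
  have hcd : (⌊c * d⌋₊ : ℝ) ≤ c * d := Nat.floor_le (by positivity)
  have hk : ⌊c * d⌋₊ ≤ d := by
    have : (⌊c * d⌋₊ : ℝ) ≤ d := hcd.trans (mul_le_of_le_one_left hd0 (min_le_left _ _))
    exact_mod_cast this
  have hcount := two_pow_le_ncard hP.spectrum hk
    (t := (1 / initialError (P d)) ^ 2) (by positivity) (by
      rw [← Real.log_lt_log_iff (by positivity) (by positivity), Real.log_pow, Real.log_pow,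
        one_div, Real.log_inv]
      have h1 : (⌊c * d⌋₊ : ℝ) * ℓ ≤ 2 * δ * d := by
        calc (⌊c * d⌋₊ : ℝ) * ℓ ≤ c * d * ℓ := by gcongr
          _ = c * ℓ * d := by ring
          _ ≤ 2 * δ * d := by gcongr
      rw [hℓ, Real.log_inv] at h1
      push_cast
      linarith)
  have h2 : ((2 : ℝ) ^ ⌊c * d⌋₊) ≤ ((largeIndices μ d ((1 / initialError (P d)) ^ 2)).ncard : ℝ) := by
    exact_mod_cast hcount
  refine le_trans ?_ h2
  rw [add_sub_cancel, ← Real.rpow_natCast, ← Real.rpow_mul zero_le_two, ← Real.rpow_natCast]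
  have h3 : (2 : ℝ) ^ (c * d) ≤ 2 ^ ((⌊c * d⌋₊ : ℝ) + 1) :=
    Real.rpow_le_rpow_of_exponent_le one_le_two (Nat.lt_floor_add_one _).le
  rw [Real.rpow_add_one two_ne_zero] at h3
  linarith

theorem HasTensorSpectrum.two_pow_le (hP : HasTensorSpectrum P μ) (h1 : μ 1 = 1) {d : ℕ} {ε : ℝ}
    (hε : 0 < ε) (hεI : ε < initialError (P d)) : 2 ^ d ≤ infoComplexity (P d) ε := by
  have hI := hP.initialError_pos d
  rw [hP.infoComplexity_eq d ε hε]
  refine two_pow_le_ncard hP.spectrum le_rfl (by positivity) ?_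
  rw [h1, one_pow]
  exact pow_lt_one₀ (by positivity) ((div_lt_one hI).2 hεI) two_ne_zero

theorem HasTensorSpectrum.curse_of_multiple (hP : HasTensorSpectrum P μ) (h1 : μ 1 = 1) {c : ℝ}
    (hc : 0 < c) (h : ∀ᶠ d : ℕ in atTop, c ≤ initialError (P d)) : CurseOfDimensionality P := by
  refine ⟨c / 2, half_pos hc, 1, one_pos, 1, one_pos, (h.mono fun d hd => ?_).frequently⟩
  have := hP.two_pow_le h1 (half_pos hc) ((half_lt_self hc).trans_le hd)
  rw [one_mul, one_add_one_eq_two]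
  exact_mod_cast this

/-- For fixed `ε`, the zero algorithm suffices as soon as the initial error is below `ε`. -/
theorem HasTensorSpectrum.not_curse (hP : HasTensorSpectrum P μ)
    (h : Tendsto (fun d => initialError (P d)) atTop (𝓝 0)) : ¬ CurseOfDimensionality P := by
  rintro ⟨ε, hε, C, hC, γ, hγ, hfreq⟩
  obtain ⟨d, hd, hlt⟩ := (hfreq.and_eventually ((tendsto_order.1 h).2 ε hε)).exists
  rw [hP.infoComplexity_eq d ε hε, largeIndices_eq_empty hP.spectrum, Set.ncard_empty] at hd
  · have : 0 < C * (1 + γ) ^ d := by positivity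
    simp only [Nat.cast_zero] at hd
    linarith
  · exact one_le_pow₀ ((one_le_div (hP.initialError_pos d)).2 hlt.le)

theorem HasTensorSpectrum.weaklyTractable_iff (hP : HasTensorSpectrum P μ) :
    WeaklyTractable P ↔ ∀ η : ℝ, 0 < η → ∃ Y : ℝ, ∀ (ε : ℝ) (d : ℕ), 0 < ε → ε ≤ 1 → 1 ≤ d →
      ε < initialError (P d) → Y ≤ ε⁻¹ + d →
      Real.log ((largeIndices μ d ((ε / initialError (P d)) ^ 2)).ncard) ≤ η * (ε⁻¹ + d) := by
  rw [IBC.weaklyTractable_iff]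
  refine forall₂_congr fun η _ => exists_congr fun Y => forall₃_congr fun ε d hε => ?_
  rw [hP.infoComplexity_eq d ε hε]

theorem HasTensorSpectrum.isLittleO_of_polynomial (hP : HasTensorSpectrum P μ) {α : ℝ}
    (hα : 0 ≤ α) {c : ℝ} (hc : 0 < c)
    (hI : ∀ᶠ d : ℕ in atTop, c * (d : ℝ) ^ α ≤ initialError (P d)) (hwt : WeaklyTractable P) :
    μ =o[atTop] fun n : ℕ => Real.log ((n + 1 : ℕ) : ℝ) ^ (-(2 * (1 + α))) := by
  obtain ⟨D, hD⟩ := eventually_atTop.1 hI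
  obtain ⟨M, δ, hM, hδ, hch⟩ := exists_choice_of_polynomial (I := fun d => initialError (P d)) hα
    (c := min c 1) (lt_min hc one_pos) (min_le_right _ _) (D := D) fun d hd =>
      (mul_le_mul_of_nonneg_right (min_le_left _ _) (by positivity)).trans (hD d hd)
  exact isLittleO_of_log_ncard_le hP.spectrum (by positivity) hM hδ hP.initialError_pos hch
    (hP.weaklyTractable_iff.1 hwt)

theorem HasTensorSpectrum.isLittleO_two (hP : HasTensorSpectrum P μ) (hwt : WeaklyTractable P) :
    μ =o[atTop] fun n : ℕ => Real.log ((n + 1 : ℕ) : ℝ) ^ (-2 : ℝ) := by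
  obtain ⟨M, δ, hM, hδ, hch⟩ := exists_choice_of_pos (I := fun d => initialError (P d))
    (hP.initialError_pos 1)
  exact isLittleO_of_log_ncard_le hP.spectrum two_pos hM hδ hP.initialError_pos hch
    (hP.weaklyTractable_iff.1 hwt)

/-- At `ε = init / 2` all `2 ^ d` indices with entries in `{0, 1}` count, so tractability forces `d
log 2 ≤ η (2 / init + d)`. -/
theorem HasTensorSpectrum.initialError_isLittleO (hP : HasTensorSpectrum P μ) (h1 : μ 1 = 1)
    (h : Tendsto (fun d => initialError (P d)) atTop (𝓝 0)) (hwt : WeaklyTractable P) :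
    (fun d => initialError (P d)) =o[atTop] fun d : ℕ => 1 / (d : ℝ) := by
  refine isLittleO_iff.2 fun c hc => ?_
  have hlog2 : 0 < Real.log 2 := Real.log_pos one_lt_two
  -- The first bound absorbs `η d` into the left side; the second turns the rest into `d ≤ c /
  -- init`.
  set η : ℝ := min (Real.log 2 / 2) (c * Real.log 2 / 4) with hη
  obtain ⟨Y, hY⟩ := IBC.weaklyTractable_iff P |>.1 hwt η (lt_min (by positivity) (by positivity))
  filter_upwards [(tendsto_order.1 h).2 1 one_pos, eventually_ge_atTop 1,
    tendsto_natCast_atTop_atTop.eventually_ge_atTop Y] with d hd1 hd hdY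
  set I : ℝ := initialError (P d) with hIdef
  have hI : 0 < I := hP.initialError_pos d
  have hd0 : (0 : ℝ) < d := by exact_mod_cast hd
  have hinv : (I / 2)⁻¹ = 2 / I := inv_div _ _
  have h2 := hY (I / 2) d (half_pos hI) (by linarith) hd (half_lt_self hI) (by
    rw [hinv]
    have : 0 < 2 / I := by positivity
    linarith)
  have h3 := (log_le_log_natCast (hP.two_pow_le h1 (half_pos hI) (half_lt_self hI))).trans h2
  push_cast at h3
  rw [Real.log_pow, hinv, mul_add] at h3
  have h4 : η * d ≤ Real.log 2 / 2 * d := mul_le_mul_of_nonneg_right (min_le_left _ _) hd0.le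
  have h5 : η * (2 / I) ≤ c * Real.log 2 / 4 * (2 / I) :=
    mul_le_mul_of_nonneg_right (min_le_right _ _) (by positivity)
  have h6 : Real.log 2 / 2 * d ≤ Real.log 2 / 2 * (c / I) := by
    have : c * Real.log 2 / 4 * (2 / I) = Real.log 2 / 2 * (c / I) := by
      field_simp
      norm_num
    linarith
  have h7 : (d : ℝ) ≤ c / I := le_of_mul_le_mul_left h6 (by positivity)
  rw [Real.norm_of_nonneg hI.le, Real.norm_of_nonneg (by positivity), mul_one_div, le_div_iff₀ hd0]
  rw [le_div_iff₀ hI] at h7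
  linarith

theorem HasTensorSpectrum.weaklyTractable_of_isLittleO (hP : HasTensorSpectrum P μ) {α : ℝ}
    (hα : 0 ≤ α)
    (hdec : μ =o[atTop] fun n : ℕ => Real.log ((n + 1 : ℕ) : ℝ) ^ (-(2 * (1 + α))))
    (hI : (fun d => initialError (P d)) =O[atTop] fun d : ℕ => (d : ℝ) ^ α)
    (hcase : μ 1 < 1 ∨ (fun d => initialError (P d)) =o[atTop] fun d : ℕ => 1 / (d : ℝ)) :
    WeaklyTractable P := by
  obtain ⟨C, hC, hCI⟩ : ∃ C : ℝ, 1 ≤ C ∧ ∀ d : ℕ, 1 ≤ d → initialError (P d) ≤ C * (d : ℝ) ^ α := by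
    obtain ⟨C, hC0, hC⟩ := hI.exists_pos
    obtain ⟨D, hD⟩ := eventually_atTop.1 hC.bound
    -- The sum dominates the finitely many initial errors outside the range of the asymptotic bound.
    refine ⟨max C (∑ d ∈ Finset.range D, initialError (P d)) + 1, ?_, fun d hd => ?_⟩
    · have := le_max_left C (∑ d ∈ Finset.range D, initialError (P d))
      linarith
    · have hdα : 1 ≤ (d : ℝ) ^ α := Real.one_le_rpow (by exact_mod_cast hd) hα
      rcases lt_or_ge d D with h | h
      · have h1 : initialError (P d) ≤ ∑ d ∈ Finset.range D, initialError (P d) :=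
          Finset.single_le_sum (f := fun d => initialError (P d))
            (fun i _ => (hP.initialError_pos i).le) (Finset.mem_range.2 h)
        have h2 := le_max_right C (∑ d ∈ Finset.range D, initialError (P d))
        have h3 := hP.initialError_pos d
        refine le_trans (by linarith) (le_mul_of_one_le_right (by linarith) hdα)
      · have h1 := hD d h
        rw [Real.norm_of_nonneg (hP.initialError_pos d).le, Real.norm_of_nonneg (by positivity)] at h1
        refine h1.trans (mul_le_mul_of_nonneg_right ?_ (by positivity))
        have := le_max_left C (∑ d ∈ Finset.range D, initialError (P d))
        linarith
  -- The two cases differ only in why `d log r` is negligible: either `r = 1`, or `ε < init =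
  -- o(1/d)` gives `d ≤ κ ε⁻¹` for large `d`.
  obtain ⟨r, hr, hr1, hdr⟩ : ∃ r : ℕ, 1 ≤ r ∧ μ r < 1 ∧ ∀ η : ℝ, 0 < η → ∃ Y : ℝ,
      ∀ (ε : ℝ) (d : ℕ), 0 < ε → ε < initialError (P d) → Y ≤ ε⁻¹ + d →
        d * Real.log r ≤ η * (ε⁻¹ + d) := by
    rcases hcase with h | h
    · refine ⟨1, le_rfl, h, fun η hη => ⟨0, fun ε d hε _ _ => ?_⟩⟩
      have := inv_pos.2 hε
      simp only [Nat.cast_one, Real.log_one, mul_zero]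
      positivity
    · obtain ⟨r, hrlt, hr⟩ := (((tendsto_order.1 hP.spectrum.tendsto).2 1 one_pos).and
        (eventually_ge_atTop 1)).exists
      refine ⟨r, hr, hrlt, fun η hη => ?_⟩
      have hlogr : 0 ≤ Real.log r := Real.log_natCast_nonneg r
      set κ : ℝ := η / (Real.log r + 1) with hκ
      have hκ0 : 0 < κ := by positivity
      have hκr : κ * Real.log r ≤ η := by
        rw [hκ, div_mul_eq_mul_div, div_le_iff₀ (by positivity)]
        nlinarith
      obtain ⟨D, hD⟩ := eventually_atTop.1 (isLittleO_iff.1 h hκ0)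
      -- This threshold settles the dimensions below `D`, where `d ≤ D ≤ κ (ε⁻¹ + d)`.
      refine ⟨D / κ, fun ε d hε hεI hY => ?_⟩
      have hε' : 0 < ε⁻¹ := inv_pos.2 hε
      have hdle : (d : ℝ) ≤ κ * (ε⁻¹ + d) := by
        rcases lt_or_ge d D with hdD | hdD
        · rw [div_le_iff₀ hκ0] at hY
          have : (d : ℝ) ≤ D := by exact_mod_cast hdD.le
          linarith
        · rcases Nat.eq_zero_or_pos d with h0 | hd0
          · rw [h0]
            push_cast
            positivity
          have hd0' : (0 : ℝ) < d := by exact_mod_cast hd0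
          have h1 := hD d hdD
          rw [Real.norm_of_nonneg (hP.initialError_pos d).le, Real.norm_of_nonneg (by positivity),
            mul_one_div, le_div_iff₀ hd0'] at h1
          have h2 : d * ε ≤ κ := by nlinarith
          rw [← le_div_iff₀ hε, div_eq_mul_inv] at h2
          have : 0 ≤ κ * d := by positivity
          linarith
      calc d * Real.log r ≤ κ * (ε⁻¹ + d) * Real.log r := by gcongr
        _ = κ * Real.log r * (ε⁻¹ + d) := by ring
        _ ≤ η * (ε⁻¹ + d) := by gcongr
  refine hP.weaklyTractable_iff.2 fun η hη => ?_
  obtain ⟨Y₁, hY₁⟩ := log_ncard_le_of_isLittleO hP.spectrum hα hdec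
    (I := fun d => initialError (P d)) (fun d _ => hP.initialError_pos d) hC hCI hr hr1 (half_pos hη)
  obtain ⟨Y₂, hY₂⟩ := hdr (η / 2) (half_pos hη)
  refine ⟨max Y₁ Y₂, fun ε d hε _ hd hεI hY => ?_⟩
  have h1 := hY₁ ε d hε hd hεI ((le_max_left _ _).trans hY)
  have h2 := hY₂ ε d hε hεI ((le_max_right _ _).trans hY)
  linarith

end Tractability

/-! ### Application to the scaled tensor problem. -/

section Main

variable {H : Type*} [NormedAddCommGroup H] [InnerProductSpace ℝ H] [CompleteSpace H]
variable {G : Type*} [NormedAddCommGroup G] [InnerProductSpace ℝ G] [CompleteSpace G]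

theorem hasTensorSpectrum_scaledTensorProblem {S : H →L[ℝ] G} (hS : IsCompactOperator S)
    (h1 : 0 < singularSq S 1) (s : ℕ → {x : ℝ // 0 < x}) :
    HasTensorSpectrum (scaledTensorProblem S s) fun n => singularSq S n / singularSq S 0 := by
  have h0 : 0 < singularSq S 0 := h1.trans_le (singularSq_antitone hS zero_le_one)
  refine ⟨⟨div_self h0.ne', div_pos h1 h0, fun n => div_nonneg (singularSq_nonneg S n) h0.le,
    fun m n hmn => div_le_div_of_nonneg_right (singularSq_antitone hS hmn) h0.le, ?_⟩,
    fun d => ?_, fun d ε hε => ?_⟩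
  · simpa using (tendsto_singularSq hS).div_const (singularSq S 0)
  · rw [initialError_scaledTensorProblem hS h0.ne']
    exact Real.sqrt_pos.2 (mul_pos (s d).2 (pow_pos h0 d))
  · rw [infoComplexity_scaledTensorProblem hS h0.ne' s d hε, largeIndices_normalize h0,
      initialError_scaledTensorProblem hS h0.ne', div_pow,
      Real.sq_sqrt (mul_nonneg (s d).2.le (pow_nonneg h0.le d)), div_div]

/-- Neither the constant factor nor the simultaneous index shift affects the asymptotics. -/
theorem isLittleO_normalized_iff {lam ν : ℕ → ℝ} (h : ∀ n, lam (n + 1) = ν n) (h0 : ν 0 ≠ 0)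
    (g : ℕ → ℝ) :
    (fun n => ν n / ν 0) =o[atTop] (fun n => g (n + 1)) ↔ lam =o[atTop] g := by
  rw [show (fun n => ν n / ν 0) = fun n => (ν 0)⁻¹ * (lam ∘ fun n => n + 1) n from
    funext fun n => by rw [Function.comp, h, div_eq_inv_mul],
    isLittleO_const_mul_left_iff (inv_ne_zero h0)]
  conv_rhs => rw [← map_add_atTop_eq_nat 1]
  rw [isLittleO_map]
  rfl

end Main

end IBC

theorem theorem3p7 {H : Type*} [NormedAddCommGroup H] [InnerProductSpace ℝ H] [CompleteSpace H]
    {G : Type*} [NormedAddCommGroup G] [InnerProductSpace ℝ G] [CompleteSpace G]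
    (S : H →L[ℝ] G) (hS : IsCompactOperator S)
    (hlam : 0 < IBC.sqSingularValue S 2)
    (s : ℕ → {x : ℝ // 0 < x}) :
    let lam : ℕ → ℝ := IBC.sqSingularValue S
    let P := IBC.scaledTensorProblem S s
    let init : ℕ → ℝ := fun d => IBC.initialError (P d)
    -- the initial error
    (∀ d : ℕ, 1 ≤ d → init d = √((s d : ℝ) * lam 1 ^ d)) ∧
    -- initial errors that grow exponentially along a subsequence of dimensions
    ((¬ ∀ δ : ℝ, 0 < δ → ∀ᶠ d : ℕ in atTop, Real.log (init d) ≤ δ * d) →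
      IBC.CurseOfDimensionality P) ∧
    -- initial errors of exact polynomial order
    (∀ α : ℝ, 0 ≤ α → init =Θ[atTop] (fun d : ℕ => (d : ℝ) ^ α) →
      (lam 1 = lam 2 → IBC.CurseOfDimensionality P) ∧
      (lam 2 < lam 1 → (IBC.WeaklyTractable P ↔
        lam =o[atTop] fun n : ℕ => Real.log n ^ (-2 * (1 + α))))) ∧
    -- initial errors that tend to zero
    (Tendsto init atTop (𝓝 0) →
      ¬ IBC.CurseOfDimensionality P ∧
      (IBC.WeaklyTractable P ↔
        (lam 1 = lam 2 ∧ (lam =o[atTop] fun n : ℕ => Real.log n ^ (-2 : ℝ)) ∧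
          init =o[atTop] fun d : ℕ => 1 / (d : ℝ)) ∨
        (lam 2 < lam 1 ∧ lam =o[atTop] fun n : ℕ => Real.log n ^ (-2 : ℝ)))) := by
  intro lam P init
  have hlam1 : ∀ n, lam (n + 1) = IBC.singularSq S n := IBC.sqSingularValue_succ hS
  have h1 : 0 < IBC.singularSq S 1 := hlam1 1 ▸ hlam
  have h0 : 0 < IBC.singularSq S 0 := h1.trans_le (IBC.singularSq_antitone hS zero_le_one)
  have hP := IBC.hasTensorSpectrum_scaledTensorProblem hS h1 s
  have hiff : ∀ β : ℝ, ((fun n => IBC.singularSq S n / IBC.singularSq S 0) =o[atTop]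
      fun n : ℕ => Real.log ((n + 1 : ℕ) : ℝ) ^ β) ↔ lam =o[atTop] fun n : ℕ => Real.log n ^ β :=
    fun β => IBC.isLittleO_normalized_iff hlam1 h0.ne' fun n : ℕ => Real.log n ^ β
  have heq : lam 1 = lam 2 → IBC.singularSq S 1 / IBC.singularSq S 0 = 1 := fun h => by
    rw [hlam1 0, hlam1 1] at h
    rw [← h, div_self h0.ne']
  have hlt : lam 2 < lam 1 → IBC.singularSq S 1 / IBC.singularSq S 0 < 1 := fun h => by
    rw [hlam1 0, hlam1 1] at h
    exact (div_lt_one h0).2 h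
  have hle : lam 2 ≤ lam 1 := by
    rw [hlam1 0, hlam1 1]
    exact IBC.singularSq_antitone hS zero_le_one
  refine ⟨fun d _ => ?_, fun h => ?_, fun α hα hΘ => ⟨fun h => ?_, fun h => ?_⟩,
    fun hlim => ⟨hP.not_curse hlim, fun hwt => ?_, ?_⟩⟩
  · rw [hlam1 0]
    exact IBC.initialError_scaledTensorProblem hS h0.ne' s d
  · push Not at h
    obtain ⟨δ, hδ, hfreq⟩ := h
    exact hP.curse_of_exponential hδ hfreq
  · obtain ⟨c, hc, hcI⟩ := hΘ.2.exists_pos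
    refine hP.curse_of_multiple (heq h) (inv_pos.2 hc) ?_
    filter_upwards [hcI.bound, eventually_ge_atTop 1] with d hd hd1
    have hdα : 1 ≤ (d : ℝ) ^ α := Real.one_le_rpow (by exact_mod_cast hd1) hα
    rw [Real.norm_of_nonneg (by positivity), Real.norm_of_nonneg (hP.initialError_pos d).le] at hd
    exact (inv_le_iff_one_le_mul₀' hc).2 (hdα.trans hd)
  · rw [neg_mul, ← hiff]
    refine ⟨fun hwt => ?_, fun hdec => hP.weaklyTractable_of_isLittleO hα hdec hΘ.1 (Or.inl (hlt h))⟩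
    obtain ⟨c, hc, hcI⟩ := hΘ.2.exists_pos
    refine hP.isLittleO_of_polynomial hα (inv_pos.2 hc) ?_ hwt
    filter_upwards [hcI.bound] with d hd
    rw [Real.norm_of_nonneg (by positivity), Real.norm_of_nonneg (hP.initialError_pos d).le] at hd
    exact (inv_mul_le_iff₀ hc).2 hd
  · have hdec := (hiff _).1 (hP.isLittleO_two hwt)
    rcases hle.eq_or_lt with h | h
    · exact Or.inl ⟨h.symm, hdec, hP.initialError_isLittleO (heq h.symm) hlim hwt⟩
    · exact Or.inr ⟨h, hdec⟩
  -- Initial errors tending to zero are bounded, so sufficiency is the case `α = 0` of the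
  -- polynomial upper bound.
  · have hbd : init =O[atTop] fun d : ℕ => (d : ℝ) ^ (0 : ℝ) := by
      simpa using hlim.isBigO_one ℝ
    have hexp : (-2 : ℝ) = -(2 * (1 + 0)) := by norm_num
    rintro (⟨-, hdec, ho⟩ | ⟨h, hdec⟩) <;> rw [← hiff, hexp] at hdec
    · exact hP.weaklyTractable_of_isLittleO le_rfl hdec hbd (Or.inr ho)
    · exact hP.weaklyTractable_of_isLittleO le_rfl hdec hbd (Or.inl (hlt h))
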